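/- Let $(\Omega,\mathcal A,(\mathcal A_t)_{t\ge 0},\mathbb P)$ be a filtered probability space with a continuous $(\mathcal A_t)$-Brownian motion $W$. Let $\sigma\in C^2(\mathbb R)$ satisfy, for constants $\sigma_0,\sigma_1,K_\sigma$ and all $x$, $0<\sigma_0^2\le\sigma^2(x)\le\sigma_1^2$ and $|\sigma'(x)|+|\sigma''(x)|\le K_\sigma$. Let $K>0$ and $\mathcal F_K=\{b\in C^1(\mathbb R): |b(x)|+|b'(x)|\le K \text{ for all } x\}$. Let $(\eta_\lambda)_{\lambda\in\Lambda}$ be $\mathcal A_0$-measurable real random variables, the possible initial variables ($\Lambda$ is an arbitrary index set, a single point if the initial distribution is known). Let $h>0$ and $t_i=ih$. Write $\theta=(b,\lambda)\in\Theta=\mathcal F_K\times\Lambda$. *Discrete Euler scheme.* $Z_0=\eta_\lambda$ and $Z_i=Z_{i-1}+h\,b(Z_{i-1})+\sqrt h\,\sigma(Z_{i-1})\varepsilon_i$ with $\varepsilon_i=(W_{t_i}-W_{t_{i-1}})/\sqrt h$. Let $Q^h_\theta$ be the law of $(Z_i)_{i\ge0}$ on $\mathbb R^{\mathbb N}$,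 let $\mathcal G_n$ be the σ-field on $\mathbb R^{\mathbb N}$ generated by the coordinates $0,\dots,n$, and let $N$ be a $(\mathcal G_n)$-stopping time (the value $\infty$ is allowed). Put $\mathcal G^{h,N}=(\mathbb R^{\mathbb N},\mathcal G_N,(Q^h_\theta|_{\mathcal G_N})_{\theta\in\Theta})$. *Continuous-time Euler scheme.* Let $\bar\xi^{\theta}$ be a continuous $(\mathcal A_t)$-adapted solution of $d\bar\xi_t=\bar b_h(t,\bar\xi)\,dt+\bar\sigma_h(t,\bar\xi)\,dW_t$, $\bar\xi_0=\eta_\lambda$, where $\bar b_h(t,x)=\sum_{i\ge1}b(x(t_{i-1}))1_{(t_{i-1},t_i]}(t)$ and $\bar\sigma_h(t,x)=\sum_{i\ge1}\sigma(x(t_{i-1}))1_{(t_{i-1},t_i]}(t)$. Let $Q_\theta$ be its law on $C(\mathbb R^+,\mathbb R)$, let $(\mathcal C_t)$ be the right-continuous canonical filtration $\mathcal C_t=\bigcap_{s>t}\sigma(x(u),u\le s)$, and let $Nh$ denote the $(\mathcal C_t)$-stopping time $x\mapsto h\,N((x(t_i))_{i\ge0})$. Put $\mathcal G_0^{Nh}=(C(\mathbb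 R^+,\mathbb R),\mathcal C_{Nh},(Q_\theta|_{\mathcal C_{Nh}})_{\theta\in\Theta})$. *Le Cam distance.* For experiments $\mathcal E=(X,\mathcal X,(P_\theta))$ and $\mathcal H=(Y,\mathcal Y,(R_\theta))$, $\Delta(\mathcal E,\mathcal H)=\max\{\delta(\mathcal E,\mathcal H),\delta(\mathcal H,\mathcal E)\}$, where $\delta(\mathcal E,\mathcal H)=\inf_M\sup_\theta\|MP_\theta-R_\theta\|_{TV}$, the infimum being over Markov kernels $M$ from $(X,\mathcal X)$ to $(Y,\mathcal Y)$ and $\|P-Q\|_{TV}=\sup_A|P(A)-Q(A)|$. **Claim.** For every $\theta\in\Theta$ a solution $\bar\xi^\theta$ exists, and for every choice of solutions: 1. $\Delta(\mathcal G^{h,N},\mathcal G_0^{Nh})=0$. 2. $\mathcal G_0^{Nh}$ is a randomization of $\mathcal G^{h,N}$ as follows. Let $B_0,B_1,\dots$ be independent standard Brownian bridges on $[0,h]$ (on any probability space). For $z\in\mathbb R^{\mathbb N}$ let $M(z,\cdot)$ be the law, restricted to $\mathcal C_{Nh}$, of the continuous path $$x(t)=z_i+\frac{t-t_i}{h}(z_{i+1}-z_i)+\sigma(z_i)B_i(t-t_i),\qquad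 t\in[t_i,t_{i+1}],\ i\ge0.$$ Then $M$ is a Markov kernel from $(\mathbb R^{\mathbb N},\mathcal G_N)$ to $(C(\mathbb R^+,\mathbb R),\mathcal C_{Nh})$ and $M(Q^h_\theta|_{\mathcal G_N})=Q_\theta|_{\mathcal C_{Nh}}$ for all $\theta\in\Theta$. -/

import Mathlib

open MeasureTheory ProbabilityTheory
open scoped NNReal ENNReal

noncomputable section

/-! ### Statistical experiments and the Le Cam distance -/

/-- A statistical experiment with sample space `X` and parameter set `Θ`: a σ-algebra on `X` and a
family of probability measures on it. -/
structure Experiment (Θ X : Type*) where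
  sigma : MeasurableSpace X
  law : Θ → @Measure X sigma
  isProb : ∀ θ, @IsProbabilityMeasure X sigma (law θ)

/-- The experiment given by the distributions of the random elements `Y θ`. -/
def Experiment.ofRandomElement {Θ X Ω : Type*} [m : MeasurableSpace Ω] (P : Measure Ω)
    [IsProbabilityMeasure P] [mX : MeasurableSpace X] (Y : Θ → Ω → X)
    (hY : ∀ θ, Measurable (Y θ)) : Experiment Θ X where
  sigma := mX
  law θ := P.map (Y θ)
  isProb θ := Measure.isProbabilityMeasure_map (hY θ).aemeasurable

/-- The restriction of an experiment to a smaller σ-algebra. -/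
def Experiment.restrict {Θ X : Type*} (E : Experiment Θ X) (m : MeasurableSpace X)
    (hm : m ≤ E.sigma) : Experiment Θ X where
  sigma := m
  law θ := (E.law θ).trim hm
  isProb θ := by
    have := E.isProb θ
    exact ⟨by rw [trim_measurableSet_eq hm MeasurableSet.univ, measure_univ]⟩

/-- Total variation distance of probability measures, `sup_A |P(A) - Q(A)|`. -/
def tvDist {X : Type*} [MeasurableSpace X] (P Q : Measure X) : ℝ≥0∞ :=
  ⨆ (A : Set X) (_ : MeasurableSet A), ENNReal.ofReal |P.real A - Q.real A|

/-- The deficiency `δ(E, F) = inf_M sup_θ ‖M P_θ - Q_θ‖_TV`, over all Markov kernels `M`. -/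
def deficiency {Θ X Y : Type*} (E : Experiment Θ X) (F : Experiment Θ Y) : ℝ≥0∞ :=
  letI := E.sigma
  letI := F.sigma
  ⨅ (M : Kernel X Y) (_ : IsMarkovKernel M), ⨆ θ, tvDist ((E.law θ).bind M) (F.law θ)

/-- The Le Cam deficiency distance. -/
def leCamDist {Θ X Y : Type*} (E : Experiment Θ X) (F : Experiment Θ Y) : ℝ≥0∞ :=
  max (deficiency E F) (deficiency F E)

/-! ### Path space and sequence space -/

/-- The space of continuous real functions on `[0, ∞)`. -/
abbrev PathSpace := C(ℝ≥0, ℝ)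

/-- The σ-algebra generated by the coordinates. -/
instance pathSigma : MeasurableSpace PathSpace :=
  ⨆ t : ℝ≥0, MeasurableSpace.comap (fun x : PathSpace => x t) inferInstance

theorem measurable_pathEval (t : ℝ≥0) : Measurable (fun x : PathSpace => x t) :=
  Measurable.of_comap_le (le_iSup (fun t : ℝ≥0 =>
    MeasurableSpace.comap (fun x : PathSpace => x t) inferInstance) t)

theorem measurable_toPath {Ω : Type*} [MeasurableSpace Ω] {ξ : Ω → PathSpace}
    (h : ∀ t, Measurable (fun ω => ξ ω t)) : Measurable ξ := by
  rw [measurable_iff_comap_le, pathSigma, MeasurableSpace.comap_iSup]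
  refine iSup_le fun t => ?_
  rw [MeasurableSpace.comap_comp]
  exact (h t).comap_le

/-- `σ(x(s), s ≤ t)`. -/
def rawPathFiltration : Filtration ℝ≥0 pathSigma :=
  Filtration.natural (fun t (x : PathSpace) => x t) fun t => (measurable_pathEval t).stronglyMeasurable

/-- The right-continuous canonical filtration, `⋂_{s > t} σ(x(u), u ≤ s)`. -/
def pathFiltration : Filtration ℝ≥0 pathSigma := rawPathFiltration.rightCont

/-- The filtration `σ(π₀, …, πₙ)` of the coordinates on the space of real sequences. -/
def seqFiltration : Filtration ℕ (MeasurableSpace.pi : MeasurableSpace (ℕ → ℝ)) :=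
  Filtration.natural (fun n (x : ℕ → ℝ) => x n) fun n => (measurable_pi_apply n).stronglyMeasurable

/-- The values `(x(ih))_{i ≥ 0}` of a path on the grid. -/
def skeleton (h : ℝ≥0) (x : PathSpace) : ℕ → ℝ := fun i => x (i * h)

/-- The random time `N h` on path space, `N` being evaluated at the values on the grid. -/
def gridTime (h : ℝ≥0) (N : (ℕ → ℝ) → WithTop ℕ) (x : PathSpace) : WithTop ℝ≥0 :=
  (N (skeleton h x)).map fun n : ℕ => (n : ℝ≥0) * h

theorem isStoppingTime_gridTime {h : ℝ≥0} (hh : 0 < h) {N : (ℕ → ℝ) → WithTop ℕ}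
    (hN : IsStoppingTime seqFiltration N) : IsStoppingTime pathFiltration (gridTime h N) := by
  intro t
  refine rawPathFiltration.le_rightCont t _ ?_
  have hset : {x : PathSpace | gridTime h N x ≤ t} = skeleton h ⁻¹' {z | N z ≤ (⌊t / h⌋₊ : ℕ)} := by
    ext x
    simp only [gridTime, Set.mem_ofPred_eq, Set.mem_preimage]
    cases N (skeleton h x) with
    | top => exact iff_of_false (WithTop.not_top_le_coe _) (WithTop.not_top_le_coe _)
    | coe n =>
      have h1 : (((n : ℝ≥0) * h : ℝ≥0) : WithTop ℝ≥0) ≤ t ↔ (n : ℝ≥0) * h ≤ t := WithTop.coe_le_coe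
      have h2 : ((n : ℕ) : WithTop ℕ) ≤ ((⌊t / h⌋₊ : ℕ) : WithTop ℕ) ↔ n ≤ ⌊t / h⌋₊ :=
        WithTop.coe_le_coe
      have h3 : n ≤ ⌊t / h⌋₊ ↔ (n : ℝ≥0) * h ≤ t := by
        rw [Nat.le_floor_iff (by positivity), le_div_iff₀ hh]
      exact h1.trans (h3.symm.trans h2.symm)
  rw [hset]
  have hmeas : @Measurable _ _ (rawPathFiltration t) (seqFiltration ⌊t / h⌋₊) (skeleton h) := by
    rw [measurable_iff_comap_le, seqFiltration, Filtration.natural]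
    simp only [MeasurableSpace.comap_iSup, MeasurableSpace.comap_comp]
    refine iSup₂_le fun i hi => ?_
    have hi' : (i : ℝ≥0) * h ≤ t := by
      rw [← le_div_iff₀ hh]
      exact (Nat.le_floor_iff (by positivity)).1 hi
    exact le_iSup₂ (f := fun (j : ℝ≥0) (_ : j ≤ t) =>
      MeasurableSpace.comap (fun x : PathSpace => x j) inferInstance) ((i : ℝ≥0) * h) hi'
  exact hmeas (hN _)

/-! ### Coefficients and driving noise -/

/-- The class of drifts `b ∈ C¹` with `|b| + |b'| ≤ K`. -/
def driftClass (K : ℝ) : Set (ℝ → ℝ) :=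
  {b | ContDiff ℝ 1 b ∧ ∀ x, |b x| + |deriv b x| ≤ K}

/-- The condition on the diffusion coefficient. -/
structure DiffusionCondition (σ : ℝ → ℝ) (σ₀ σ₁ Kσ : ℝ) : Prop where
  contDiff : ContDiff ℝ 2 σ
  pos : 0 < σ₀ ^ 2
  lower : ∀ x, σ₀ ^ 2 ≤ σ x ^ 2
  upper : ∀ x, σ x ^ 2 ≤ σ₁ ^ 2
  deriv_le : ∀ x, |deriv σ x| + |deriv (deriv σ) x| ≤ Kσ

/-- `W` is a Brownian motion with respect to the filtration `𝒜`, with continuous paths. -/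
structure IsFilteredBrownian {Ω : Type*} [m : MeasurableSpace Ω] (𝒜 : Filtration ℝ≥0 m)
    (W : ℝ≥0 → Ω → ℝ) (P : Measure Ω) : Prop where
  brownian : IsBrownianReal W P
  continuous : ∀ ω, Continuous fun t => W t ω
  adapted : ∀ t, Measurable[𝒜 t] (W t)
  indep : ∀ s t, s ≤ t →
    Indep (MeasurableSpace.comap (fun ω => W t ω - W s ω) inferInstance) (𝒜 s) P

/-! ### The two Euler schemes -/

/-- The discrete Euler scheme `Z₀ = η`, `Z_{i+1} = Z_i + h b(Z_i) + √h σ(Z_i) ε_{i+1}`, where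
`ε_{i+1} = (W_{(i+1)h} - W_{ih}) / √h`. -/
def eulerScheme {Ω : Type*} (σ b : ℝ → ℝ) (h : ℝ≥0) (W : ℝ≥0 → Ω → ℝ) (η : Ω → ℝ) (ω : Ω) : ℕ → ℝ
  | 0 => η ω
  | i + 1 =>
    let z := eulerScheme σ b h W η ω i
    z + h * b z + √(h : ℝ) * σ z * ((W ((i + 1 : ℕ) * h) ω - W (i * h) ω) / √(h : ℝ))

theorem measurable_eulerScheme {Ω : Type*} [MeasurableSpace Ω] {σ b : ℝ → ℝ} (h : ℝ≥0)
    {W : ℝ≥0 → Ω → ℝ} {η : Ω → ℝ} (hσ : Measurable σ) (hb : Measurable b)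
    (hW : ∀ t, Measurable (W t)) (hη : Measurable η) : Measurable (eulerScheme σ b h W η) := by
  refine measurable_pi_lambda _ fun i => ?_
  induction i with
  | zero => simpa only [eulerScheme] using hη
  | succ i ih =>
    simp only [eulerScheme]
    have h1 := hW ((i + 1 : ℕ) * h)
    have h2 := hW (i * h)
    have h3 := hσ.comp ih
    have h4 := hb.comp ih
    exact (ih.add (h4.const_mul _)).add ((h3.const_mul _).mul ((h1.sub h2).div_const _))

/-- The path-dependent coefficient `∑_{i ≥ 1} f(x(t_{i-1})) 1_{(t_{i-1}, t_i]}(s)`, `t_i = i h`. -/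
def eulerCoeff (f : ℝ → ℝ) (h : ℝ≥0) (s : ℝ≥0) (x : PathSpace) : ℝ :=
  ∑' i : ℕ, (Set.Ioc ((i : ℝ≥0) * h) ((i + 1 : ℕ) * h)).indicator (fun _ => f (x (i * h))) s

/-- The Itô integral over `(0, t]`, with respect to the path `w`, of the simple integrand
`∑_i H_i 1_{(ih, (i+1)h]}`; only finitely many terms do not vanish. -/
def simpleItoIntegral (h : ℝ≥0) (H : ℕ → ℝ) (w : ℝ≥0 → ℝ) (t : ℝ≥0) : ℝ :=
  ∑' i : ℕ, H i * (w (min t ((i + 1 : ℕ) * h)) - w (min t (i * h)))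

/-- `ξ` is a (continuous, adapted) solution of the stochastic differential equation
`dξ_t = b̄_h(t, ξ) dt + σ̄_h(t, ξ) dW_t`, `ξ_0 = η`, with `b̄_h = eulerCoeff b h` and
`σ̄_h = eulerCoeff σ h`. -/
structure IsContinuousEuler {Ω : Type*} [m : MeasurableSpace Ω] (𝒜 : Filtration ℝ≥0 m)
    (W : ℝ≥0 → Ω → ℝ) (P : Measure Ω) (σ b : ℝ → ℝ) (h : ℝ≥0) (η : Ω → ℝ)
    (ξ : Ω → PathSpace) : Prop where
  adapted : ∀ t, Measurable[𝒜 t] fun ω => ξ ω t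
  equation : ∀ᵐ ω ∂P, ∀ t : ℝ≥0, ξ ω t = η ω
    + (∫ s in (0 : ℝ)..t, eulerCoeff b h s.toNNReal (ξ ω))
    + simpleItoIntegral h (fun i => σ (ξ ω (i * h))) (fun s => W s ω) t

theorem IsContinuousEuler.measurable {Ω : Type*} [m : MeasurableSpace Ω]
    {𝒜 : Filtration ℝ≥0 m} {W : ℝ≥0 → Ω → ℝ} {P : Measure Ω} {σ b : ℝ → ℝ} {h : ℝ≥0}
    {η : Ω → ℝ} {ξ : Ω → PathSpace} (hξ : IsContinuousEuler 𝒜 W P σ b h η ξ) : Measurable ξ :=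
  measurable_toPath fun t => (hξ.adapted t).mono (𝒜.le t) le_rfl

/-- The experiment of the discrete Euler scheme observed up to the stopping time `N`. The parameter
is the drift together with the label of the initial variable. -/
def discreteEulerExperiment {Ω Λ : Type*} [m : MeasurableSpace Ω] {P : Measure Ω}
    [IsProbabilityMeasure P] {𝒜 : Filtration ℝ≥0 m} {W : ℝ≥0 → Ω → ℝ}
    (hW : IsFilteredBrownian 𝒜 W P) {σ : ℝ → ℝ} {σ₀ σ₁ Kσ : ℝ}
    (hσ : DiffusionCondition σ σ₀ σ₁ Kσ) (K : ℝ) {η : Λ → Ω → ℝ}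
    (hη : ∀ l, Measurable[𝒜 0] (η l)) (h : ℝ≥0) {N : (ℕ → ℝ) → WithTop ℕ}
    (hN : IsStoppingTime seqFiltration N) : Experiment (driftClass K × Λ) (ℕ → ℝ) :=
  (Experiment.ofRandomElement P
    (fun θ : driftClass K × Λ => eulerScheme σ (θ.1 : ℝ → ℝ) h W (η θ.2))
    (fun θ => measurable_eulerScheme h hσ.contDiff.continuous.measurable
      θ.1.2.1.continuous.measurable (fun t => (hW.adapted t).mono (𝒜.le t) le_rfl)
      ((hη θ.2).mono (𝒜.le 0) le_rfl))).restrict hN.measurableSpace hN.measurableSpace_le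

/-- The experiment of the continuous-time Euler scheme observed up to the stopping time `N h`. -/
def continuousEulerExperiment {Ω Λ : Type*} [m : MeasurableSpace Ω] {P : Measure Ω}
    [IsProbabilityMeasure P] {𝒜 : Filtration ℝ≥0 m} {W : ℝ≥0 → Ω → ℝ} {σ : ℝ → ℝ} {K : ℝ}
    {η : Λ → Ω → ℝ} {h : ℝ≥0} (hh : 0 < h) {ξ : driftClass K × Λ → Ω → PathSpace}
    (hξ : ∀ θ, IsContinuousEuler 𝒜 W P σ (θ.1 : ℝ → ℝ) h (η θ.2) (ξ θ))
    {N : (ℕ → ℝ) → WithTop ℕ} (hN : IsStoppingTime seqFiltration N) :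
    Experiment (driftClass K × Λ) PathSpace :=
  (Experiment.ofRandomElement P ξ fun θ => (hξ θ).measurable).restrict
    (isStoppingTime_gridTime hh hN).measurableSpace
    (isStoppingTime_gridTime hh hN).measurableSpace_le

/-! ### Interpolation by Brownian bridges -/

/-- `B`, on the time interval `[0, h]`, is a standard Brownian bridge from `0` to `0`. -/
structure IsBrownianBridge {Ω : Type*} [MeasurableSpace Ω] (h : ℝ≥0) (B : ℝ≥0 → Ω → ℝ)
    (P : Measure Ω) : Prop where
  gaussian : IsGaussianProcess (fun t : Set.Icc (0 : ℝ≥0) h => B t) P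
  mean : ∀ t ≤ h, ∫ ω, B t ω ∂P = 0
  covariance : ∀ s t, s ≤ t → t ≤ h → cov[B s, B t; P] = (s : ℝ) - s * t / h
  continuous : ∀ᵐ ω ∂P, ContinuousOn (fun t => B t ω) (Set.Icc 0 h)

/-- A sequence of independent Brownian bridges on `[0, h]`. -/
structure IsIndepBridges {Ω : Type*} [MeasurableSpace Ω] (h : ℝ≥0) (B : ℕ → ℝ≥0 → Ω → ℝ)
    (P : Measure Ω) : Prop where
  bridge : ∀ i, IsBrownianBridge h (B i) P
  indep : iIndepFun (fun (i : ℕ) (ω : Ω) (t : Set.Icc (0 : ℝ≥0) h) => B i t ω) P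

/-- The path `x` is the linear interpolation of the points `(ih, z_i)` plus, on each interval
`[ih, (i+1)h]`, the term `σ(z_i) β_i(t - ih)`. -/
def IsBridgedPath (σ : ℝ → ℝ) (h : ℝ≥0) (z : ℕ → ℝ) (β : ℕ → ℝ≥0 → ℝ) (x : PathSpace) : Prop :=
  ∀ (i : ℕ) (u : ℝ≥0), u ≤ h →
    x (i * h + u) = z i + u / h * (z (i + 1) - z i) + σ (z i) * β i u

/-- The experiment `F` is the image of `E` under the randomization that sends a sequence `z` to the
law of the path interpolating `z` by the random bridges `B`: this is a Markov kernel for the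
σ-algebras of the two experiments, and it maps each law of `E` to that of `F`. -/
def IsBridgeRandomization {Θ Ω : Type*} [MeasurableSpace Ω] (σ : ℝ → ℝ) (h : ℝ≥0)
    (B : ℕ → ℝ≥0 → Ω → ℝ) (P : Measure Ω) (E : Experiment Θ (ℕ → ℝ))
    (F : Experiment Θ PathSpace) : Prop :=
  ∃ M : @Kernel (ℕ → ℝ) PathSpace E.sigma F.sigma,
    @IsMarkovKernel _ _ E.sigma F.sigma M ∧
    (∀ z A, MeasurableSet[F.sigma] A →
      M z A = P {ω | ∃ x ∈ A, IsBridgedPath σ h z (fun i u => B i u ω) x}) ∧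
    ∀ θ, @Measure.bind _ _ E.sigma F.sigma (E.law θ) M = F.law θ

end

/-! ### Path space -/

/-! Write `Z` for the discrete scheme. On each grid cell the drift of the continuous scheme is
constant, so it is absorbed by the chord: the scheme is the linear interpolation of `Z` plus `σ (Z
i)` times the bridge of `W` on that cell. Almost surely, then, every solution is `interpPath` of `Z`
and of these bridges (`euler_equation_iff_eq_interpPath`). The bridges are jointly Gaussian and
uncorrelated with the grid increments of `W`, and both together are independent of the initial
variable. As `Z` is a function of the increments and the initial variable, it is independent of the
bridges (`indepFun_eulerScheme_pathBridge`). Hence the law of the path given `Z = z` is the law of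
`z` interpolated by bridges, which is free of the parameter; conversely, reading the path on the
grid returns `Z`.

There remains measurability for the stopped σ-algebras. The delicate point is that `M z A`, for `A`
in the past of `Nh`, depends on `z` only through the past of `N`. On `N ≤ n` this means that for `A`
in the right-continuous past of `nh` only `z 0, …, z n` matter, and this for every `z`. Such an `A`
may look slightly beyond `nh`, where the path already leans towards `z (n + 1)`. But a change of `z
(n + 1)` adds a linear function on `[nh, nh + ε]`, which has the same effect there as translating
one standard Gaussian variable by an amount of order `√ε`. The cost in total variation tends to zero
with `ε` (`measure_interpPath_le`, `measure_interpPath_eq`); division by `σ (z n)` is where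
nondegeneracy enters.

The kernel is built from the bridges of `W`; `IsIndepBridges.exists_measurable` shows that any other
independent bridges give the same one. -/

theorem pathSigma_eq_comap :
    pathSigma = MeasurableSpace.comap (fun (x : PathSpace) (t : ℝ≥0) => x t) MeasurableSpace.pi := by
  simp only [pathSigma, MeasurableSpace.pi, MeasurableSpace.comap_iSup, MeasurableSpace.comap_comp]
  rfl

theorem measurable_pathCoe : Measurable (fun (x : PathSpace) (t : ℝ≥0) => x t) :=
  measurable_pi_lambda _ measurable_pathEval

theorem PathSpace.measure_ext {μ ν : Measure PathSpace}
    (h : μ.map (fun (x : PathSpace) (t : ℝ≥0) => x t) = ν.map (fun (x : PathSpace) (t : ℝ≥0) => x t)) :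
    μ = ν := by
  ext A hA
  rw [pathSigma_eq_comap] at hA
  obtain ⟨S, hS, rfl⟩ := hA
  rw [← Measure.map_apply measurable_pathCoe hS, h, Measure.map_apply measurable_pathCoe hS]

/-- Transfers independence between real-valued processes and path-valued variables. -/
theorem comap_pathSigma {Ω : Type*} (ξ : Ω → PathSpace) :
    MeasurableSpace.comap ξ pathSigma =
      MeasurableSpace.comap (fun ω (t : ℝ≥0) => ξ ω t) MeasurableSpace.pi := by
  rw [pathSigma_eq_comap, MeasurableSpace.comap_comp]
  rfl

/-! ### Interpolation of a sequence by bridges -/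

noncomputable section

/-- The path obtained from the restriction of `w` to `[0, h]` by subtracting the chord; it is
constant after `h`. -/
def bridgeOf (h : ℝ≥0) (w : PathSpace) : PathSpace where
  toFun u := w (min u h) - w 0 - ((min u h : ℝ≥0) : ℝ) / h * (w h - w 0)
  continuous_toFun := by fun_prop

theorem bridgeOf_apply (h : ℝ≥0) (w : PathSpace) (u : ℝ≥0) :
    bridgeOf h w u = w (min u h) - w 0 - ((min u h : ℝ≥0) : ℝ) / h * (w h - w 0) := rfl

theorem bridgeOf_zero (h : ℝ≥0) (w : PathSpace) : bridgeOf h w 0 = 0 := by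
  simp [bridgeOf_apply]

theorem bridgeOf_of_ge {h : ℝ≥0} (hh : 0 < h) (w : PathSpace) {u : ℝ≥0} (hu : h ≤ u) :
    bridgeOf h w u = 0 := by
  have : (h : ℝ) ≠ 0 := by exact_mod_cast hh.ne'
  simp [bridgeOf_apply, hu, this]

theorem bridgeOf_of_le {h : ℝ≥0} {w : PathSpace} (h0 : w 0 = 0) (hw : w h = 0) {u : ℝ≥0}
    (hu : u ≤ h) : bridgeOf h w u = w u := by
  simp [bridgeOf_apply, hu, h0, hw]

theorem bridgeOf_congr {h : ℝ≥0} {w w' : PathSpace} (hw : ∀ u ≤ h, w u = w' u) :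
    bridgeOf h w = bridgeOf h w' := by
  ext u
  simp only [bridgeOf_apply, hw _ (min_le_right u h), hw 0 zero_le, hw h le_rfl]

theorem measurable_bridgeOf (h : ℝ≥0) : Measurable (bridgeOf h) :=
  measurable_toPath fun t => by
    simp only [bridgeOf_apply]
    exact ((measurable_pathEval _).sub (measurable_pathEval _)).sub
      (((measurable_pathEval _).sub (measurable_pathEval _)).const_mul _)

/-- The increment of `interpPath` on the interval `[ih, (i+1)h]`. -/
def interpTerm (σ : ℝ → ℝ) (h : ℝ≥0) (z : ℕ → ℝ) (w : ℕ → PathSpace) (i : ℕ) (t : ℝ≥0) : ℝ :=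
  ((min (t - i * h) h : ℝ≥0) : ℝ) / h * (z (i + 1) - z i) + σ (z i) * bridgeOf h (w i) (t - i * h)

theorem continuous_interpTerm (σ : ℝ → ℝ) (h : ℝ≥0) (z : ℕ → ℝ) (w : ℕ → PathSpace) (i : ℕ) :
    Continuous (interpTerm σ h z w i) := by
  have h1 : Continuous fun t : ℝ≥0 => t - i * h := by fun_prop
  unfold interpTerm
  fun_prop

theorem interpTerm_of_le {σ : ℝ → ℝ} {h : ℝ≥0} {z : ℕ → ℝ} {w : ℕ → PathSpace} {i : ℕ} {t : ℝ≥0}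
    (ht : t ≤ i * h) : interpTerm σ h z w i t = 0 := by
  simp [interpTerm, tsub_eq_zero_of_le ht, bridgeOf_zero]

theorem interpTerm_of_ge {σ : ℝ → ℝ} {h : ℝ≥0} (hh : 0 < h) {z : ℕ → ℝ} {w : ℕ → PathSpace} {i : ℕ}
    {t : ℝ≥0} (ht : (i + 1 : ℕ) * h ≤ t) : interpTerm σ h z w i t = z (i + 1) - z i := by
  have h1 : h ≤ t - i * h := by
    refine le_tsub_of_add_le_left ?_
    push_cast at ht
    linarith
  have : (h : ℝ) ≠ 0 := by exact_mod_cast hh.ne'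
  simp [interpTerm, bridgeOf_of_ge hh _ h1, h1, this]

theorem tsum_interpTerm {σ : ℝ → ℝ} {h : ℝ≥0} {z : ℕ → ℝ} {w : ℕ → PathSpace} {n : ℕ} {t : ℝ≥0}
    (ht : t ≤ n * h) :
    ∑' i, interpTerm σ h z w i t = ∑ i ∈ Finset.range n, interpTerm σ h z w i t := by
  refine tsum_eq_sum fun i hi => interpTerm_of_le (ht.trans ?_)
  have : n ≤ i := by simpa using hi
  gcongr

theorem exists_lt_nat_mul {h : ℝ≥0} (hh : 0 < h) (t : ℝ≥0) : ∃ n : ℕ, t < n * h := by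
  obtain ⟨n, hn⟩ := exists_nat_gt (t / h)
  exact ⟨n, (div_lt_iff₀ hh).1 hn⟩

/-- Near any time only finitely many terms are nonzero. -/
theorem continuous_interp (σ : ℝ → ℝ) {h : ℝ≥0} (hh : 0 < h) (z : ℕ → ℝ) (w : ℕ → PathSpace) :
    Continuous fun t => z 0 + ∑' i, interpTerm σ h z w i t := by
  refine continuous_const.add (continuous_iff_continuousAt.2 fun t => ?_)
  obtain ⟨n, hn⟩ := exists_lt_nat_mul hh t
  have hc : Continuous fun t => ∑ i ∈ Finset.range n, interpTerm σ h z w i t :=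
    continuous_finsetSum _ fun i _ => continuous_interpTerm σ h z w i
  refine hc.continuousAt.congr ?_
  filter_upwards [Iio_mem_nhds hn] with s hs
  exact (tsum_interpTerm (le_of_lt hs)).symm

/-- The path interpolating `z` on the grid `(ih)` by the bridges of the paths `w i`. -/
def interpPath (σ : ℝ → ℝ) {h : ℝ≥0} (hh : 0 < h) (z : ℕ → ℝ) (w : ℕ → PathSpace) : PathSpace where
  toFun t := z 0 + ∑' i, interpTerm σ h z w i t
  continuous_toFun := continuous_interp σ hh z w

theorem interpPath_eq_sum {σ : ℝ → ℝ} {h : ℝ≥0} (hh : 0 < h) {z : ℕ → ℝ} {w : ℕ → PathSpace} {n : ℕ}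
    {t : ℝ≥0} (ht : t ≤ n * h) :
    interpPath σ hh z w t = z 0 + ∑ i ∈ Finset.range n, interpTerm σ h z w i t :=
  congrArg (z 0 + ·) (tsum_interpTerm ht)

/-- The terms of completed cells telescope to `z i - z 0`, and those of later cells vanish. -/
theorem isBridgedPath_interpPath (σ : ℝ → ℝ) {h : ℝ≥0} (hh : 0 < h) (z : ℕ → ℝ)
    (w : ℕ → PathSpace) :
    IsBridgedPath σ h z (fun i u => bridgeOf h (w i) u) (interpPath σ hh z w) := by
  intro i u hu
  have h1 : (i * h + u : ℝ≥0) ≤ (i + 1 : ℕ) * h := by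
    push_cast
    rw [add_one_mul]
    gcongr
  rw [interpPath_eq_sum hh h1, Finset.sum_range_succ]
  have h2 : ∑ j ∈ Finset.range i, interpTerm σ h z w j (i * h + u) = z i - z 0 := by
    rw [← Finset.sum_range_sub]
    refine Finset.sum_congr rfl fun j hj => interpTerm_of_ge hh ?_
    have : j + 1 ≤ i := Finset.mem_range.1 hj
    refine le_add_right ?_
    gcongr
  rw [h2, interpTerm]
  simp only [add_tsub_cancel_left, min_eq_left hu]
  ring

theorem exists_grid_add {h : ℝ≥0} (hh : 0 < h) (t : ℝ≥0) :
    ∃ (i : ℕ) (u : ℝ≥0), u < h ∧ t = i * h + u := by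
  have h1 : (⌊t / h⌋₊ : ℝ≥0) * h ≤ t := by
    rw [← le_div_iff₀ hh]
    exact Nat.floor_le zero_le
  refine ⟨⌊t / h⌋₊, t - ⌊t / h⌋₊ * h, ?_, (add_tsub_cancel_of_le h1).symm⟩
  rw [tsub_lt_iff_left h1, ← add_one_mul, ← div_lt_iff₀ hh]
  exact Nat.lt_floor_add_one _

theorem IsBridgedPath.unique {σ : ℝ → ℝ} {h : ℝ≥0} (hh : 0 < h) {z : ℕ → ℝ} {β β' : ℕ → ℝ≥0 → ℝ}
    {x y : PathSpace} (hx : IsBridgedPath σ h z β x) (hy : IsBridgedPath σ h z β' y)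
    (hβ : ∀ i, ∀ u ≤ h, β i u = β' i u) : x = y := by
  ext t
  obtain ⟨i, u, hu, rfl⟩ := exists_grid_add hh t
  rw [hx i u hu.le, hy i u hu.le, hβ i u hu.le]

theorem skeleton_interpPath (σ : ℝ → ℝ) {h : ℝ≥0} (hh : 0 < h) (z : ℕ → ℝ) (w : ℕ → PathSpace) :
    skeleton h (interpPath σ hh z w) = z := by
  ext i
  have := isBridgedPath_interpPath σ hh z w i 0 zero_le
  simpa [bridgeOf_zero, skeleton] using this

/-- Removing the chord twice is the same as removing it once, so shifted Brownian paths may be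
replaced by their bridges. -/
theorem interpPath_bridgeOf (σ : ℝ → ℝ) {h : ℝ≥0} (hh : 0 < h) (z : ℕ → ℝ) (w : ℕ → PathSpace) :
    interpPath σ hh z (fun i => bridgeOf h (w i)) = interpPath σ hh z w :=
  (isBridgedPath_interpPath σ hh z _).unique hh (isBridgedPath_interpPath σ hh z w) fun i _ hu =>
    bridgeOf_of_le (bridgeOf_zero h (w i)) (bridgeOf_of_ge hh (w i) le_rfl) hu

theorem measurable_interpPath {σ : ℝ → ℝ} (hσ : Measurable σ) {h : ℝ≥0} (hh : 0 < h) :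
    Measurable fun p : (ℕ → ℝ) × (ℕ → PathSpace) => interpPath σ hh p.1 p.2 := by
  refine measurable_toPath fun t => ?_
  obtain ⟨n, hn⟩ := exists_lt_nat_mul hh t
  simp only [interpPath_eq_sum hh hn.le]
  have hz : ∀ i, Measurable fun p : (ℕ → ℝ) × (ℕ → PathSpace) => p.1 i := fun i =>
    (measurable_pi_apply i).comp measurable_fst
  refine (hz 0).add (Finset.measurable_sum _ fun i _ => ?_)
  have hw : Measurable fun p : (ℕ → ℝ) × (ℕ → PathSpace) => bridgeOf h (p.2 i) (t - i * h) :=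
    (measurable_pathEval _).comp ((measurable_bridgeOf h).comp
      ((measurable_pi_apply i).comp measurable_snd))
  exact (((hz _).sub (hz _)).const_mul _).add ((hσ.comp (hz i)).mul hw)

end

/-! ### Pathwise solution of the continuous-time Euler scheme -/

theorem eulerCoeff_of_mem {f : ℝ → ℝ} {h : ℝ≥0} {x : PathSpace} {i : ℕ} {s : ℝ≥0}
    (hs : s ∈ Set.Ioc ((i : ℝ≥0) * h) ((i + 1 : ℕ) * h)) : eulerCoeff f h s x = f (x (i * h)) := by
  rw [eulerCoeff, tsum_eq_single i, Set.indicator_of_mem hs]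
  intro j hj
  refine Set.indicator_of_notMem (fun hj' => ?_) _
  rcases lt_or_gt_of_ne hj with hlt | hlt
  · have h1 : ((j + 1 : ℕ) : ℝ≥0) * h ≤ i * h := by gcongr; exact hlt
    exact absurd (hj'.2.trans h1) (not_le.2 hs.1)
  · have h1 : ((i + 1 : ℕ) : ℝ≥0) * h ≤ j * h := by gcongr; exact hlt
    exact absurd (hs.2.trans h1) (not_le.2 hj'.1)

theorem eulerCoeff_toNNReal_eqOn {f : ℝ → ℝ} {h : ℝ≥0} {x : PathSpace} {i : ℕ} {u : ℝ≥0}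
    (hu : u ≤ h) :
    Set.EqOn (fun _ : ℝ => f (x (i * h))) (fun s : ℝ => eulerCoeff f h s.toNNReal x)
      (Set.uIoc ((i : ℝ) * h) (i * h + u)) := by
  intro s hs
  rw [Set.uIoc_of_le (by simp)] at hs
  refine (eulerCoeff_of_mem ⟨?_, ?_⟩).symm
  · rw [← NNReal.coe_lt_coe, Real.coe_toNNReal _ (le_trans (by positivity) hs.1.le)]
    exact_mod_cast hs.1
  · rw [← NNReal.coe_le_coe, Real.coe_toNNReal _ (le_trans (by positivity) hs.1.le)]
    push_cast
    have : (u : ℝ) ≤ h := by exact_mod_cast hu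
    linarith [hs.2]

theorem intervalIntegrable_eulerCoeff_step (f : ℝ → ℝ) {h : ℝ≥0} (x : PathSpace) (i : ℕ) {u : ℝ≥0}
    (hu : u ≤ h) :
    IntervalIntegrable (fun s : ℝ => eulerCoeff f h s.toNNReal x) volume
      ((i : ℝ) * h) (i * h + u) :=
  (intervalIntegrable_const (c := f (x (i * h)))).congr (eulerCoeff_toNNReal_eqOn hu)

theorem intervalIntegrable_eulerCoeff (f : ℝ → ℝ) (h : ℝ≥0) (x : PathSpace) (i : ℕ) :
    IntervalIntegrable (fun s : ℝ => eulerCoeff f h s.toNNReal x) volume 0 ((i : ℝ) * h) := by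
  induction i with
  | zero => simp
  | succ i ih =>
    have := ih.trans (intervalIntegrable_eulerCoeff_step f x i le_rfl)
    simpa [add_one_mul] using this

theorem integral_eulerCoeff_add (f : ℝ → ℝ) {h : ℝ≥0} (x : PathSpace) (i : ℕ) {u : ℝ≥0}
    (hu : u ≤ h) :
    ∫ s in (0 : ℝ)..(i * h + u : ℝ≥0), eulerCoeff f h s.toNNReal x =
      (∫ s in (0 : ℝ)..(i * h : ℝ≥0), eulerCoeff f h s.toNNReal x) + u * f (x (i * h)) := by
  push_cast
  rw [← intervalIntegral.integral_add_adjacent_intervals (intervalIntegrable_eulerCoeff f h x i)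
    (intervalIntegrable_eulerCoeff_step f x i hu)]
  congr 1
  rw [← intervalIntegral.integral_congr_ae (ae_of_all _ (eulerCoeff_toNNReal_eqOn (f := f) hu))]
  simp

theorem simpleItoIntegral_eq_sum {h : ℝ≥0} (H : ℕ → ℝ) (w : ℝ≥0 → ℝ) {n : ℕ} {t : ℝ≥0}
    (ht : t ≤ n * h) : simpleItoIntegral h H w t =
      ∑ i ∈ Finset.range n, H i * (w (min t ((i + 1 : ℕ) * h)) - w (min t (i * h))) := by
  refine tsum_eq_sum fun i hi => ?_
  have hi' : n ≤ i := by simpa using hi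
  have h1 : t ≤ i * h := ht.trans (by gcongr)
  have h2 : t ≤ (i + 1 : ℕ) * h := h1.trans (by gcongr; simp)
  simp only [min_eq_left h1, min_eq_left h2, sub_self, mul_zero]

theorem simpleItoIntegral_zero (h : ℝ≥0) (H : ℕ → ℝ) (w : ℝ≥0 → ℝ) :
    simpleItoIntegral h H w 0 = 0 := by
  simp [simpleItoIntegral]

theorem simpleItoIntegral_add {h : ℝ≥0} (H : ℕ → ℝ) (w : ℝ≥0 → ℝ) (i : ℕ) {u : ℝ≥0} (hu : u ≤ h) :
    simpleItoIntegral h H w (i * h + u) =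
      simpleItoIntegral h H w (i * h) + H i * (w (i * h + u) - w (i * h)) := by
  have h1 : (i * h + u : ℝ≥0) ≤ (i + 1 : ℕ) * h := by
    push_cast
    rw [add_one_mul]
    gcongr
  rw [simpleItoIntegral_eq_sum H w h1, simpleItoIntegral_eq_sum H w (le_refl (i * h)),
    Finset.sum_range_succ, min_eq_left h1, min_eq_right (le_add_of_nonneg_right zero_le)]
  congr 1
  refine Finset.sum_congr rfl fun j hj => ?_
  have hj' : j + 1 ≤ i := Finset.mem_range.1 hj
  have h2 : ((j + 1 : ℕ) : ℝ≥0) * h ≤ i * h := by gcongr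
  have h3 : (j : ℝ≥0) * h ≤ i * h := by gcongr; omega
  have h4 : (i * h : ℝ≥0) ≤ i * h + u := le_add_of_nonneg_right zero_le
  rw [min_eq_right h2, min_eq_right h3, min_eq_right (h2.trans h4), min_eq_right (h3.trans h4)]

/-- The integral equation of the continuous-time Euler scheme, solved interval by interval. -/
theorem euler_equation_iff (σ b : ℝ → ℝ) {h : ℝ≥0} (hh : 0 < h) (y : ℝ) (w : ℝ≥0 → ℝ)
    (x : PathSpace) :
    (∀ t : ℝ≥0, x t = y + (∫ s in (0 : ℝ)..t, eulerCoeff b h s.toNNReal x)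
      + simpleItoIntegral h (fun i => σ (x (i * h))) w t) ↔
    x 0 = y ∧ ∀ (i : ℕ) (u : ℝ≥0), u ≤ h → x (i * h + u) =
      x (i * h) + u * b (x (i * h)) + σ (x (i * h)) * (w (i * h + u) - w (i * h)) := by
  constructor
  · intro hx
    refine ⟨by simpa [simpleItoIntegral_zero] using hx 0, fun i u hu => ?_⟩
    rw [hx (i * h + u), integral_eulerCoeff_add b x i hu, simpleItoIntegral_add _ w i hu]
    linarith [hx (i * h)]
  · rintro ⟨h0, hx⟩ t
    have hgrid : ∀ i : ℕ, x (i * h) = y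
        + (∫ s in (0 : ℝ)..(i * h : ℝ≥0), eulerCoeff b h s.toNNReal x)
        + simpleItoIntegral h (fun i => σ (x (i * h))) w (i * h) := by
      intro i
      induction i with
      | zero => simp [simpleItoIntegral_zero, h0]
      | succ i ih =>
        have e : ((i + 1 : ℕ) : ℝ≥0) * h = i * h + h := by push_cast; ring
        rw [e, integral_eulerCoeff_add b x i le_rfl, simpleItoIntegral_add _ w i le_rfl,
          hx i h le_rfl]
        linarith
    obtain ⟨i, u, hu, rfl⟩ := exists_grid_add hh t
    rw [integral_eulerCoeff_add b x i hu.le, simpleItoIntegral_add _ w i hu.le, hx i u hu.le]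
    linarith [hgrid i]

noncomputable section

/-- The path `w` read from each grid point on. -/
def shiftedPaths (h : ℝ≥0) {w : ℝ≥0 → ℝ} (hw : Continuous w) (i : ℕ) : PathSpace where
  toFun u := w (i * h + u)
  continuous_toFun := by fun_prop

end

theorem bridgeOf_shiftedPaths {h : ℝ≥0} {w : ℝ≥0 → ℝ} (hw : Continuous w) (i : ℕ) (u : ℝ≥0) :
    bridgeOf h (shiftedPaths h hw i) u = w (i * h + min u h) - w (i * h)
      - ((min u h : ℝ≥0) : ℝ) / h * (w ((i + 1 : ℕ) * h) - w (i * h)) := by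
  have e : ((i + 1 : ℕ) : ℝ≥0) * h = i * h + h := by push_cast; ring
  rw [e]
  simp [bridgeOf_apply, shiftedPaths]

theorem eulerScheme_succ {Ω : Type*} (σ b : ℝ → ℝ) {h : ℝ≥0} (hh : 0 < h) (W : ℝ≥0 → Ω → ℝ)
    (η : Ω → ℝ) (ω : Ω) (i : ℕ) :
    eulerScheme σ b h W η ω (i + 1) = eulerScheme σ b h W η ω i
      + h * b (eulerScheme σ b h W η ω i)
      + σ (eulerScheme σ b h W η ω i) * (W ((i + 1 : ℕ) * h) ω - W (i * h) ω) := by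
  have : √(h : ℝ) ≠ 0 := (Real.sqrt_pos.2 (by exact_mod_cast hh)).ne'
  rw [eulerScheme]
  field_simp

/-- The Gaussian part of `u / h * (z (i + 1) - z i)` cancels the chord removed from the Brownian
increment, leaving the drift `u * b (z i)` and the increment itself. -/
theorem interpPath_euler_step {Ω : Type*} (σ b : ℝ → ℝ) {h : ℝ≥0} (hh : 0 < h) {W : ℝ≥0 → Ω → ℝ}
    (η : Ω → ℝ) (ω : Ω) (hW : Continuous fun t => W t ω) (i : ℕ) {u : ℝ≥0} (hu : u ≤ h) :
    interpPath σ hh (eulerScheme σ b h W η ω) (shiftedPaths h hW) (i * h + u) =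
      eulerScheme σ b h W η ω i + u * b (eulerScheme σ b h W η ω i)
        + σ (eulerScheme σ b h W η ω i) * (W (i * h + u) ω - W (i * h) ω) := by
  have hh' : (h : ℝ) ≠ 0 := by exact_mod_cast hh.ne'
  rw [isBridgedPath_interpPath σ hh _ _ i u hu]
  beta_reduce
  rw [bridgeOf_shiftedPaths, eulerScheme_succ σ b hh,
    min_eq_left hu]
  field_simp
  ring

theorem interpPath_euler_grid {Ω : Type*} (σ b : ℝ → ℝ) {h : ℝ≥0} (hh : 0 < h) {W : ℝ≥0 → Ω → ℝ}
    (η : Ω → ℝ) (ω : Ω) (hW : Continuous fun t => W t ω) (i : ℕ) :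
    interpPath σ hh (eulerScheme σ b h W η ω) (shiftedPaths h hW) (i * h) =
      eulerScheme σ b h W η ω i :=
  congrFun (skeleton_interpPath σ hh (eulerScheme σ b h W η ω) (shiftedPaths h hW)) i

/-- Existence and pathwise uniqueness at once: the equation determines the grid values by recursion,
and then the path inside each cell. -/
theorem euler_equation_iff_eq_interpPath {Ω : Type*} (σ b : ℝ → ℝ) {h : ℝ≥0} (hh : 0 < h)
    {W : ℝ≥0 → Ω → ℝ} (η : Ω → ℝ) (ω : Ω) (hW : Continuous fun t => W t ω) (x : PathSpace) :
    (∀ t : ℝ≥0, x t = η ω + (∫ s in (0 : ℝ)..t, eulerCoeff b h s.toNNReal x)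
      + simpleItoIntegral h (fun i => σ (x (i * h))) (fun s => W s ω) t) ↔
    x = interpPath σ hh (eulerScheme σ b h W η ω) (shiftedPaths h hW) := by
  rw [euler_equation_iff σ b hh]
  constructor
  · rintro ⟨h0, hx⟩
    have hgrid : ∀ i : ℕ, x (i * h) = eulerScheme σ b h W η ω i := by
      intro i
      induction i with
      | zero => simpa [eulerScheme] using h0
      | succ i ih =>
        have e : ((i + 1 : ℕ) : ℝ≥0) * h = i * h + h := by push_cast; ring
        rw [eulerScheme_succ σ b hh, e, hx i h le_rfl, ih]
    ext t
    obtain ⟨i, u, hu, rfl⟩ := exists_grid_add hh t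
    rw [hx i u hu.le, interpPath_euler_step σ b hh η ω hW i hu.le, hgrid]
  · rintro rfl
    refine ⟨?_, fun i u hu => ?_⟩
    · simpa [eulerScheme] using interpPath_euler_grid σ b hh η ω hW 0
    · rw [interpPath_euler_step σ b hh η ω hW i hu, interpPath_euler_grid]

theorem measurable_eulerScheme_filtration {Ω : Type*} [m : MeasurableSpace Ω]
    {𝒜 : Filtration ℝ≥0 m} {W : ℝ≥0 → Ω → ℝ} (hW : ∀ t, Measurable[𝒜 t] (W t)) {σ b : ℝ → ℝ}
    (hσ : Measurable σ) (hb : Measurable b) (h : ℝ≥0) {η : Ω → ℝ} (hη : Measurable[𝒜 0] η) (i : ℕ) :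
    Measurable[𝒜 (i * h)] fun ω => eulerScheme σ b h W η ω i := by
  induction i with
  | zero => exact hη.mono (𝒜.mono zero_le) le_rfl
  | succ i ih =>
    have hle : (i * h : ℝ≥0) ≤ (i + 1 : ℕ) * h := by gcongr; simp
    have ih' := ih.mono (𝒜.mono hle) le_rfl
    simp only [eulerScheme]
    have h1 := hW ((i + 1 : ℕ) * h)
    have h2 := (hW (i * h)).mono (𝒜.mono hle) le_rfl
    have h3 := hσ.comp ih'
    have h4 := hb.comp ih'
    exact (ih'.add (h4.const_mul _)).add ((h3.const_mul _).mul ((h1.sub h2).div_const _))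

theorem isContinuousEuler_interpPath {Ω : Type*} [m : MeasurableSpace Ω] {P : Measure Ω}
    {𝒜 : Filtration ℝ≥0 m} {W : ℝ≥0 → Ω → ℝ} (hW : IsFilteredBrownian 𝒜 W P) {σ b : ℝ → ℝ}
    (hσ : Measurable σ) (hb : Measurable b) {h : ℝ≥0} (hh : 0 < h) {η : Ω → ℝ}
    (hη : Measurable[𝒜 0] η) :
    IsContinuousEuler 𝒜 W P σ b h η fun ω =>
      interpPath σ hh (eulerScheme σ b h W η ω) (shiftedPaths h (hW.continuous ω)) where
  adapted t := by
    obtain ⟨i, u, hu, rfl⟩ := exists_grid_add hh t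
    -- The interpolation seems to anticipate the next grid value; in this form only `W` up to the
    -- current time occurs.
    simp only [interpPath_euler_step σ b hh η _ (hW.continuous _) i hu.le]
    have hle : (i * h : ℝ≥0) ≤ i * h + u := le_add_of_nonneg_right zero_le
    have h0 := (measurable_eulerScheme_filtration hW.adapted hσ hb h hη i).mono (𝒜.mono hle) le_rfl
    have h1 := hW.adapted (i * h + u)
    have h2 := (hW.adapted (i * h)).mono (𝒜.mono hle) le_rfl
    exact (h0.add ((hb.comp h0).const_mul _)).add ((hσ.comp h0).mul (h1.sub h2))
  equation := ae_of_all _ fun ω =>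
    (euler_equation_iff_eq_interpPath σ b hh η ω (hW.continuous ω) _).2 rfl

theorem IsContinuousEuler.ae_eq_interpPath {Ω : Type*} [m : MeasurableSpace Ω] {P : Measure Ω}
    {𝒜 : Filtration ℝ≥0 m} {W : ℝ≥0 → Ω → ℝ} {σ b : ℝ → ℝ} {h : ℝ≥0} {η : Ω → ℝ}
    {ξ : Ω → PathSpace} (hξ : IsContinuousEuler 𝒜 W P σ b h η ξ) (hh : 0 < h)
    (hW : ∀ ω, Continuous fun t => W t ω) :
    ξ =ᵐ[P] fun ω => interpPath σ hh (eulerScheme σ b h W η ω) (shiftedPaths h (hW ω)) := by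
  filter_upwards [hξ.equation] with ω hω
  exact (euler_equation_iff_eq_interpPath σ b hh η ω (hW ω) _).1 hω

/-! ### Laws of Gaussian processes and of continuous processes -/

theorem IsGaussianProcess.map_restrict_eq {T Ω Ω' : Type*} [MeasurableSpace Ω] [MeasurableSpace Ω']
    {P : Measure Ω} {P' : Measure Ω'} {X : T → Ω → ℝ} {Y : T → Ω' → ℝ}
    (hX : IsGaussianProcess X P) (hY : IsGaussianProcess Y P')
    (hm : ∀ t, ∫ ω, X t ω ∂P = ∫ ω, Y t ω ∂P')
    (hc : ∀ s t, cov[X s, X t; P] = cov[Y s, Y t; P']) (I : Finset T) :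
    P.map (fun ω => I.restrict (X · ω)) = P'.map (fun ω => I.restrict (Y · ω)) := by
  have mX : AEMeasurable (fun ω => I.restrict (X · ω)) P :=
    aemeasurable_pi_lambda _ fun _ => hX.aemeasurable _
  have mY : AEMeasurable (fun ω => I.restrict (Y · ω)) P' :=
    aemeasurable_pi_lambda _ fun _ => hY.aemeasurable _
  -- The covariance form needs an inner product, so both laws are carried to Euclidean space.
  apply (MeasurableEquiv.toLp 2 (_ → ℝ)).map_measurableEquiv_injective
  rw [MeasurableEquiv.coe_toLp, ← PiLp.coe_symm_continuousLinearEquiv 2 ℝ]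
  have := (hX.hasGaussianLaw I).isGaussian_map
  have := (hY.hasGaussianLaw I).isGaussian_map
  apply IsGaussian.ext
  · rw [integral_map, integral_map, integral_map, integral_map]
    · simp only [id_eq]
      rw [ContinuousLinearEquiv.integral_comp_comm, ContinuousLinearEquiv.integral_comp_comm]
      congr 1
      ext i
      rw [eval_integral, eval_integral]
      · exact hm _
      · exact fun _ => (hY.hasGaussianLaw_eval _).integrable
      · exact fun _ => (hX.hasGaussianLaw_eval _).integrable
    all_goals fun_prop
  · rw [← ContinuousLinearMap.toBilinForm_inj]
    refine LinearMap.BilinForm.ext_of_isSymm isPosSemidef_covarianceBilin.isSymm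
      isPosSemidef_covarianceBilin.isSymm fun x => ?_
    simp only [ContinuousLinearMap.toBilinForm_apply]
    rw [PiLp.coe_symm_continuousLinearEquiv, covarianceBilin_apply_pi, covarianceBilin_apply_pi]
    · congrm ∑ i, ∑ j, _ * ?_
      rw [covariance_map, covariance_map]
      · exact hc i j
      any_goals exact Measurable.aestronglyMeasurable (by fun_prop)
      all_goals assumption
    · exact fun i => ((hY.hasGaussianLaw I).isGaussian_map.hasGaussianLaw_id.eval i).memLp_two
    · exact fun i => ((hX.hasGaussianLaw I).isGaussian_map.hasGaussianLaw_id.eval i).memLp_two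

/-- Both laws, read on the product space, are projective limits of the same finite-dimensional
Gaussian laws. -/
theorem IsGaussianProcess.map_path_eq {Ω Ω' : Type*} [MeasurableSpace Ω] [MeasurableSpace Ω']
    {P : Measure Ω} {P' : Measure Ω'} {X : Ω → PathSpace} {Y : Ω' → PathSpace}
    (mX : Measurable X) (mY : Measurable Y)
    (hX : IsGaussianProcess (fun (t : ℝ≥0) ω => X ω t) P)
    (hY : IsGaussianProcess (fun (t : ℝ≥0) ω => Y ω t) P')
    (hm : ∀ t, ∫ ω, X ω t ∂P = ∫ ω, Y ω t ∂P')
    (hc : ∀ s t, cov[fun ω => X ω s, fun ω => X ω t; P] = cov[fun ω => Y ω s, fun ω => Y ω t; P']) :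
    P.map X = P'.map Y := by
  have := hX.isProbabilityMeasure
  have := hY.isProbabilityMeasure
  apply PathSpace.measure_ext
  rw [Measure.map_map measurable_pathCoe mX, Measure.map_map measurable_pathCoe mY]
  have h1 := isProjectiveLimit_map (X := fun (t : ℝ≥0) ω => X ω t) (P := P)
    (measurable_pathCoe.comp mX).aemeasurable
  have h2 := isProjectiveLimit_map (X := fun (t : ℝ≥0) ω => Y ω t) (P := P')
    (measurable_pathCoe.comp mY).aemeasurable
  simp_rw [IsGaussianProcess.map_restrict_eq hX hY hm hc] at h1
  exact h1.unique h2

/-- The coordinates are only almost everywhere measurable and the paths only almost surely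
continuous. Off a measurable null set the process agrees with measurable versions at countably many
dense times; continuity carries measurability to all times. -/
theorem exists_measurable_path {Ω : Type*} [MeasurableSpace Ω] {P : Measure Ω} {X : ℝ≥0 → Ω → ℝ}
    (hX : ∀ t, AEMeasurable (X t) P) (hc : ∀ᵐ ω ∂P, Continuous fun t => X t ω) :
    ∃ ξ : Ω → PathSpace, Measurable ξ ∧ ∀ᵐ ω ∂P, ∀ t, ξ ω t = X t ω := by
  classical
  let q := TopologicalSpace.denseSeq ℝ≥0
  have hgood : ∀ᵐ ω ∂P, (Continuous fun t => X t ω) ∧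
      ∀ n, X (q n) ω = (hX (q n)).mk (X (q n)) ω :=
    hc.and (ae_all_iff.2 fun n => (hX (q n)).ae_eq_mk)
  obtain ⟨G, hGae, hGm, hG⟩ := hgood.exists_measurable_mem
  let ξ : Ω → PathSpace := fun ω =>
    if hω : ω ∈ G then ⟨fun t => X t ω, (hG ω hω).1⟩ else 0
  refine ⟨ξ, measurable_toPath fun t => ?_, ?_⟩
  · have hq : ∀ n, Measurable fun ω => ξ ω (q n) := by
      intro n
      have : (fun ω => ξ ω (q n)) = G.indicator ((hX (q n)).mk (X (q n))) := by
        ext ω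
        by_cases hω : ω ∈ G
        · simp [ξ, hω, ← (hG ω hω).2 n]
        · simp [ξ, hω]
      rw [this]
      exact (hX (q n)).measurable_mk.indicator hGm
    obtain ⟨s, hs, hst⟩ := mem_closure_iff_seq_limit.1
      ((TopologicalSpace.denseRange_denseSeq ℝ≥0) t)
    refine measurable_of_tendsto_metrizable (f := fun n ω => ξ ω (s n)) (fun n => ?_) ?_
    · obtain ⟨k, hk⟩ := hs n
      rw [← hk]
      exact hq k
    · exact tendsto_pi_nhds.2 fun ω => ((ξ ω).continuous.tendsto t).comp hst
  · filter_upwards [hGae] with ω hω t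
    simp [ξ, hω]

/-! ### Independence -/

/-- Associativity of the product of the three laws. -/
theorem IndepFun.prodMk_right_of_prodMk_left {Ω α β γ : Type*} [MeasurableSpace Ω]
    [MeasurableSpace α] [MeasurableSpace β] [MeasurableSpace γ] {P : Measure Ω}
    [IsProbabilityMeasure P] {X : Ω → α} {Y : Ω → β} {Z : Ω → γ} (mX : Measurable X)
    (mY : Measurable Y) (mZ : Measurable Z) (h1 : IndepFun (fun ω => (X ω, Y ω)) Z P)
    (h2 : IndepFun X Y P) : IndepFun X (fun ω => (Y ω, Z ω)) P := by
  have h3 : IndepFun Y Z P := h1.comp measurable_snd measurable_id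
  rw [indepFun_iff_map_prod_eq_prod_map_map mX.aemeasurable (mY.prodMk mZ).aemeasurable,
    h3.map_prod_eq_prod_map_map mY.aemeasurable mZ.aemeasurable]
  have := Measure.isProbabilityMeasure_map (μ := P) mX.aemeasurable
  have := Measure.isProbabilityMeasure_map (μ := P) mY.aemeasurable
  have := Measure.isProbabilityMeasure_map (μ := P) mZ.aemeasurable
  rw [← Measure.prodAssoc_prod, ← h2.map_prod_eq_prod_map_map mX.aemeasurable mY.aemeasurable,
    ← h1.map_prod_eq_prod_map_map (mX.prodMk mY).aemeasurable mZ.aemeasurable,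
    Measure.map_map (by fun_prop) (by fun_prop)]
  rfl

/-- Finitely many times suffice. They are added in increasing order: each new increment is
independent of the past, which contains `η` and the earlier values. -/
theorem IsFilteredBrownian.indepFun_process {Ω : Type*} [m : MeasurableSpace Ω] {P : Measure Ω}
    [IsProbabilityMeasure P] {𝒜 : Filtration ℝ≥0 m} {W : ℝ≥0 → Ω → ℝ}
    (hW : IsFilteredBrownian 𝒜 W P) {η : Ω → ℝ} (hη : Measurable[𝒜 0] η) :
    IndepFun η (fun ω t => W t ω - W 0 ω) P := by
  classical
  have mW : ∀ t, Measurable (W t) := fun t => (hW.adapted t).mono (𝒜.le t) le_rfl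
  have mη : Measurable η := hη.mono (𝒜.le 0) le_rfl
  have key : ∀ I : Finset ℝ≥0,
      IndepFun η (fun ω t => if t ∈ I then W t ω - W 0 ω else 0) P := by
    intro I
    induction I using Finset.induction_on_max with
    | empty => simpa using indepFun_const_right η (fun _ : ℝ≥0 => (0 : ℝ))
    | insert t I hI ih =>
      -- `s` is the last time already treated, or `0` if there is none.
      obtain ⟨s, hst, hs, hsI⟩ : ∃ s ≤ t, (∀ i ∈ I, i ≤ s) ∧ (s = 0 ∨ s ∈ I) := by
        rcases I.eq_empty_or_nonempty with rfl | hne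
        · exact ⟨0, zero_le, by simp, Or.inl rfl⟩
        · exact ⟨I.max' hne, (hI _ (I.max'_mem hne)).le, fun i hi => I.le_max' i hi,
            Or.inr (I.max'_mem hne)⟩
      have mY : ∀ r, (∀ i ∈ I, i ≤ r) →
          Measurable[𝒜 r] fun ω (t : ℝ≥0) => if t ∈ I then W t ω - W 0 ω else 0 := by
        intro r hr
        refine @measurable_pi_lambda _ _ _ (𝒜 r) _ _ fun i => ?_
        by_cases hi : i ∈ I
        · simp only [hi, if_true]
          exact ((hW.adapted i).mono (𝒜.mono (hr i hi)) le_rfl).sub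
            ((hW.adapted 0).mono (𝒜.mono zero_le) le_rfl)
        · simp only [hi, if_false]
          exact @measurable_const _ _ _ (𝒜 r) _
      have h1 : IndepFun (fun ω => (η ω, fun t : ℝ≥0 => if t ∈ I then W t ω - W 0 ω else 0))
          (fun ω => W t ω - W s ω) P := by
        refine (indep_of_indep_of_le_right (hW.indep s t hst) ?_).symm
        exact (Measurable.prodMk (m := 𝒜 s) (hη.mono (𝒜.mono zero_le) le_rfl)
          (mY s hs)).comap_le
      have h2 := IndepFun.prodMk_right_of_prodMk_left mη ((mY s hs).mono (𝒜.le s) le_rfl)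
        (Z := fun ω => W t ω - W s ω) ((mW t).sub (mW s)) h1 ih
      let F : (ℝ≥0 → ℝ) × ℝ → ℝ≥0 → ℝ := fun p i => if i = t then p.2 + p.1 s else p.1 i
      have mF : Measurable F := by
        refine measurable_pi_lambda _ fun i => ?_
        by_cases hi : i = t
        · simp only [F, hi, if_true]
          exact measurable_snd.add ((measurable_pi_apply s).comp measurable_fst)
        · simp only [F, hi, if_false]
          exact (measurable_pi_apply i).comp measurable_fst
      have h3 := h2.comp measurable_id mF
      have e : F ∘ (fun ω => (fun t : ℝ≥0 => if t ∈ I then W t ω - W 0 ω else 0, W t ω - W s ω)) =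
          fun ω i => if i ∈ insert t I then W i ω - W 0 ω else 0 := by
        ext ω i
        by_cases hi : i = t
        -- If `s = 0` is not in `I`, the default value `0` is still the correct one, `W 0 ω - W 0
        -- ω`.
        · have hs' : (if s ∈ I then W s ω - W 0 ω else 0) = W s ω - W 0 ω := by
            rcases hsI with rfl | hs'
            · simp
            · simp [hs']
          simp [F, hi, hs']
        · simp [F, hi]
      rwa [e] at h3
  refine IndepFun.indepFun_process mη (fun t => (mW t).sub (mW 0)) fun I => ?_
  have := (key I).comp measurable_id (Finset.measurable_restrict I)
  have e : (fun ω (i : I) => W i ω - W 0 ω) =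
      I.restrict ∘ fun ω t => if t ∈ I then W t ω - W 0 ω else 0 := by
    funext ω i
    simp [Finset.restrict]
  rw [e]
  exact this

/-! ### The bridges of a Brownian motion -/

noncomputable section

/-- The bridge of `W` on the interval `[ih, (i+1)h]`. -/
def pathBridge {Ω : Type*} (h : ℝ≥0) {W : ℝ≥0 → Ω → ℝ} (hW : ∀ ω, Continuous fun t => W t ω)
    (ω : Ω) (i : ℕ) : PathSpace :=
  bridgeOf h (shiftedPaths h (hW ω) i)

/-- The covariance of the Brownian bridge on `[0, h]`, stopped at time `h`. -/
def bridgeCov (h s t : ℝ≥0) : ℝ :=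
  (min (min s h) (min t h) : ℝ≥0) - ((min s h : ℝ≥0) : ℝ) * (min t h : ℝ≥0) / h

end

theorem covariance_congr_ae {Ω : Type*} [MeasurableSpace Ω] {P : Measure Ω} {X X' Y Y' : Ω → ℝ}
    (hX : X =ᵐ[P] X') (hY : Y =ᵐ[P] Y') : cov[X, Y; P] = cov[X', Y'; P] := by
  rw [covariance, covariance, integral_congr_ae hX, integral_congr_ae hY]
  refine integral_congr_ae ?_
  filter_upwards [hX, hY] with ω h1 h2
  rw [h1, h2]

section Bridges

variable {Ω : Type*} {W : ℝ≥0 → Ω → ℝ} {h : ℝ≥0}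

theorem pathBridge_apply (hc : ∀ ω, Continuous fun t => W t ω) (ω : Ω) (i : ℕ) (u : ℝ≥0) :
    pathBridge h hc ω i u = (W (i * h + min u h) ω - W (i * h) ω)
      - ((min u h : ℝ≥0) : ℝ) / h * (W (i * h + h) ω - W (i * h) ω) := by
  have e : ((i + 1 : ℕ) : ℝ≥0) * h = i * h + h := by push_cast; ring
  rw [pathBridge, bridgeOf_shiftedPaths, e]

theorem bridgeOf_pathBridge (hh : 0 < h) (hc : ∀ ω, Continuous fun t => W t ω) (ω : Ω) (i : ℕ) :
    bridgeOf h (pathBridge h hc ω i) = pathBridge h hc ω i := by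
  ext u
  rcases le_total u h with hu | hu
  · exact bridgeOf_of_le (bridgeOf_zero _ _) (bridgeOf_of_ge hh _ le_rfl) hu
  · rw [bridgeOf_of_ge hh _ hu, pathBridge, bridgeOf_of_ge hh _ hu]

variable [MeasurableSpace Ω] {P : Measure Ω}

theorem measurable_pathBridge (hc : ∀ ω, Continuous fun t => W t ω) (hm : ∀ t, Measurable (W t)) :
    Measurable (pathBridge h hc) := by
  refine measurable_pi_lambda _ fun i => (measurable_bridgeOf h).comp (measurable_toPath fun t => ?_)
  exact hm _

theorem covariance_increment (hB : IsPreBrownianReal W P) {i j : ℕ} {u v : ℝ≥0} (hu : u ≤ h)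
    (hv : v ≤ h) :
    cov[fun ω => W (i * h + u) ω - W (i * h) ω, fun ω => W (j * h + v) ω - W (j * h) ω; P] =
      if i = j then ((min u v : ℝ≥0) : ℝ) else 0 := by
  have := hB.isGaussianProcess.isProbabilityMeasure
  rw [covariance_fun_sub_fun_sub]
  · simp_rw [hB.covariance_fun_eval]
    have key : ∀ {i j : ℕ} {u v : ℝ≥0}, u ≤ h → i < j →
        (((min (i * h + u) (j * h + v) : ℝ≥0) : ℝ) - (min (i * h + u) (j * h) : ℝ≥0)
          - (min (i * h) (j * h + v) : ℝ≥0) + (min (i * h) (j * h) : ℝ≥0)) = 0 := by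
      intro i j u v hu hij
      have h1 : (i * h + u : ℝ≥0) ≤ j * h := by
        calc (i * h + u : ℝ≥0) ≤ i * h + h := by gcongr
          _ = (i + 1 : ℕ) * h := by push_cast; ring
          _ ≤ j * h := by gcongr; exact hij
      have h2 : (i * h : ℝ≥0) ≤ j * h := (le_add_of_nonneg_right zero_le).trans h1
      have h3 : (j * h : ℝ≥0) ≤ j * h + v := le_add_of_nonneg_right zero_le
      rw [min_eq_left h1, min_eq_left h2, min_eq_left (h1.trans h3), min_eq_left (h2.trans h3)]
      ring
    rcases lt_trichotomy i j with hij | rfl | hij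
    · rw [if_neg hij.ne]
      linarith [key (v := v) hu hij]
    · have h1 : ∀ x : ℝ≥0, (i * h : ℝ≥0) ≤ i * h + x := fun x => le_add_of_nonneg_right zero_le
      rw [if_pos rfl, min_add_add_left, min_self, min_eq_right (h1 u), min_eq_left (h1 v)]
      push_cast
      ring
    · rw [if_neg hij.ne']
      have := key (v := u) hv hij
      rw [min_comm, min_comm (j * h + v), min_comm (j * h), min_comm (j * h)] at this
      linarith
  all_goals exact (hB.isGaussianProcess.hasGaussianLaw_eval _).memLp_two

theorem memLp_increment (hB : IsPreBrownianReal W P) (i : ℕ) (u : ℝ≥0) :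
    MemLp (fun ω => W (i * h + u) ω - W (i * h) ω) 2 P :=
  hB.isGaussianProcess.hasGaussianLaw_fun_sub.memLp_two

theorem covariance_increment_pathBridge (hB : IsPreBrownianReal W P)
    (hc : ∀ ω, Continuous fun t => W t ω) (i j : ℕ) {u : ℝ≥0} (hu : u ≤ h) (v : ℝ≥0) :
    cov[fun ω => W (i * h + u) ω - W (i * h) ω, fun ω => pathBridge h hc ω j v; P] =
      if i = j then ((min u (min v h) : ℝ≥0) : ℝ) - u * (min v h : ℝ≥0) / h else 0 := by
  have := hB.isGaussianProcess.isProbabilityMeasure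
  simp_rw [pathBridge_apply]
  rw [covariance_fun_sub_right (memLp_increment hB i u) (memLp_increment hB j _)
    ((memLp_increment hB j _).const_mul _), covariance_const_mul_right,
    covariance_increment hB hu (min_le_right _ _), covariance_increment hB hu le_rfl]
  split_ifs
  · rw [min_eq_left hu]
    ring
  · simp

theorem memLp_pathBridge (hB : IsPreBrownianReal W P) (hc : ∀ ω, Continuous fun t => W t ω) (i : ℕ)
    (u : ℝ≥0) : MemLp (fun ω => pathBridge h hc ω i u) 2 P := by
  simp_rw [pathBridge_apply]
  exact (memLp_increment hB i _).sub ((memLp_increment hB i _).const_mul _)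

theorem covariance_pathBridge (hB : IsPreBrownianReal W P) (hh : 0 < h)
    (hc : ∀ ω, Continuous fun t => W t ω) (i j : ℕ) (u v : ℝ≥0) :
    cov[fun ω => pathBridge h hc ω i u, fun ω => pathBridge h hc ω j v; P] =
      if i = j then bridgeCov h u v else 0 := by
  have := hB.isGaussianProcess.isProbabilityMeasure
  have hh' : (h : ℝ) ≠ 0 := by exact_mod_cast hh.ne'
  have e : (fun ω => pathBridge h hc ω i u) = fun ω => (W (i * h + min u h) ω - W (i * h) ω)
      - ((min u h : ℝ≥0) : ℝ) / h * (W (i * h + h) ω - W (i * h) ω) := by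
    ext ω
    rw [pathBridge_apply]
  rw [e, covariance_fun_sub_left (memLp_increment hB i _) ((memLp_increment hB i _).const_mul _)
    (memLp_pathBridge hB hc j v), covariance_const_mul_left,
    covariance_increment_pathBridge hB hc i j (min_le_right _ _),
    covariance_increment_pathBridge hB hc i j le_rfl]
  split_ifs
  · rw [bridgeCov, min_eq_right (a := h) (min_le_right _ _)]
    field_simp
    ring
  · simp

theorem integral_pathBridge (hB : IsPreBrownianReal W P) (hc : ∀ ω, Continuous fun t => W t ω)
    (i : ℕ) (u : ℝ≥0) : ∫ ω, pathBridge h hc ω i u ∂P = 0 := by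
  have := hB.isGaussianProcess.isProbabilityMeasure
  simp_rw [pathBridge_apply]
  have hd : ∀ v, ∫ ω, (W (i * h + v) ω - W (i * h) ω) ∂P = 0 := fun v => by
    rw [integral_sub (hB.integrable_eval _) (hB.integrable_eval _), hB.integral_eval,
      hB.integral_eval, sub_zero]
  rw [integral_sub ((memLp_increment hB i _).integrable (by norm_num))
    (((memLp_increment hB i _).integrable (by norm_num)).const_mul _), integral_const_mul, hd, hd]
  simp

/-- Increments and bridges are linear in finitely many values of `W`. Joint Gaussianity is what
turns vanishing covariances into independence. -/
theorem isGaussianProcess_increment_pathBridge (hB : IsPreBrownianReal W P)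
    (hc : ∀ ω, Continuous fun t => W t ω) :
    IsGaussianProcess (Sum.elim (fun (i : ℕ) ω => W (i * h + h) ω - W (i * h) ω)
      (fun (p : (_ : ℕ) × ℝ≥0) ω => pathBridge h hc ω p.1 p.2)) P := by
  classical
  refine hB.isGaussianProcess.of_isGaussianProcess ?_
  rintro (i | ⟨i, u⟩)
  · exact ⟨{i * h + h, i * h},
      { toFun x := x ⟨i * h + h, by simp⟩ - x ⟨i * h, by simp⟩
        map_add' x y := by simp; ring
        map_smul' c x := by simp; ring }, by simp⟩
  · refine ⟨{i * h + min u h, i * h, i * h + h},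
      { toFun x := (x ⟨i * h + min u h, by simp⟩ - x ⟨i * h, by simp⟩)
          - ((min u h : ℝ≥0) : ℝ) / h * (x ⟨i * h + h, by simp⟩ - x ⟨i * h, by simp⟩)
        map_add' x y := by simp; ring
        map_smul' c x := by simp; ring }, fun ω => ?_⟩
    simp only [Sum.elim_inr, pathBridge_apply]
    rfl

theorem isGaussianProcess_pathBridge (hB : IsPreBrownianReal W P)
    (hc : ∀ ω, Continuous fun t => W t ω) :
    IsGaussianProcess (fun (p : (_ : ℕ) × ℝ≥0) ω => pathBridge h hc ω p.1 p.2) P :=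
  (isGaussianProcess_increment_pathBridge hB hc).comp_right Sum.inr

/-- A sequence of paths is read as one real process indexed by pairs, the form required by the
Gaussian independence criterion. -/
theorem comap_pathSeq {Ω : Type*} (ξ : Ω → ℕ → PathSpace) :
    MeasurableSpace.comap ξ MeasurableSpace.pi =
      MeasurableSpace.comap (fun ω (p : (_ : ℕ) × ℝ≥0) => ξ ω p.1 p.2) MeasurableSpace.pi := by
  simp only [MeasurableSpace.pi, pathSigma, MeasurableSpace.comap_iSup, MeasurableSpace.comap_comp,
    iSup_sigma]
  rfl

/-- Within a cell the covariance of the full increment with the bridge at `v ≤ h` is `v - h * v / h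
= 0`. -/
theorem indepFun_increment_pathBridge (hB : IsPreBrownianReal W P) (hh : 0 < h)
    (hc : ∀ ω, Continuous fun t => W t ω) :
    IndepFun (fun ω (i : ℕ) => W (i * h + h) ω - W (i * h) ω) (pathBridge h hc) P := by
  have hG := isGaussianProcess_increment_pathBridge (h := h) hB hc
  have h1 := hG.indepFun_of_covariance_eq_zero (fun i => hG.aemeasurable (Sum.inl i))
    (fun p => hG.aemeasurable (Sum.inr p)) fun i p => by
      rw [covariance_increment_pathBridge hB hc i p.1 le_rfl]
      have : (h : ℝ) ≠ 0 := by exact_mod_cast hh.ne'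
      split_ifs
      · rw [min_eq_right (min_le_right _ _)]
        field_simp
        ring
      · rfl
  rw [IndepFun_iff_Indep] at h1 ⊢
  rwa [comap_pathSeq]

theorem iIndepFun_pathBridge (hB : IsPreBrownianReal W P) (hh : 0 < h)
    (hc : ∀ ω, Continuous fun t => W t ω) :
    iIndepFun (fun i ω => pathBridge h hc ω i) P := by
  have hG := isGaussianProcess_pathBridge (h := h) hB hc
  have h1 := IsGaussianProcess.iIndepFun_of_covariance_eq_zero (S := fun _ : ℕ => ℝ≥0)
    (X := fun i u ω => pathBridge h hc ω i u) hG (fun i u => hG.aemeasurable ⟨i, u⟩)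
    fun i j hij u v => by rw [covariance_pathBridge hB hh hc, if_neg hij]
  rw [iIndepFun_iff_iIndep] at h1 ⊢
  convert h1 using 2 with i
  exact comap_pathSigma _

/-- Independent Brownian bridges are, up to modification, a sequence of random paths whose law is
that of the bridges of a Brownian motion. -/
theorem IsIndepBridges.exists_measurable {Ω' : Type*} [MeasurableSpace Ω'] {P' : Measure Ω'}
    [IsProbabilityMeasure P'] {B : ℕ → ℝ≥0 → Ω' → ℝ} (hI : IsIndepBridges h B P')
    (hB : IsPreBrownianReal W P) (hh : 0 < h) (hc : ∀ ω, Continuous fun t => W t ω)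
    (hm : ∀ t, Measurable (W t)) :
    ∃ β : Ω' → ℕ → PathSpace, Measurable β ∧ P'.map β = P.map (pathBridge h hc) ∧
      ∀ᵐ ω ∂P', ∀ i, ∀ u ≤ h, bridgeOf h (β ω i) u = B i u ω := by
  have := hB.isGaussianProcess.isProbabilityMeasure
  have hmin : ∀ t : ℝ≥0, min t h ∈ Set.Icc 0 h := fun t => ⟨zero_le, min_le_right _ _⟩
  -- Stopping at `h` extends the bridges to all times, hence to elements of path space.
  have hG : ∀ i, IsGaussianProcess (fun t : ℝ≥0 => B i (min t h)) P' := fun i =>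
    ((hI.bridge i).gaussian).comp_right fun t => (⟨min t h, hmin t⟩ : Set.Icc (0 : ℝ≥0) h)
  have mP : ∀ i, Measurable fun ω => pathBridge h hc ω i := fun i =>
    (measurable_pi_apply i).comp (measurable_pathBridge hc hm)
  have hex : ∀ i, ∃ ξ : Ω' → PathSpace, Measurable ξ ∧
      ∀ᵐ ω ∂P', ∀ t, ξ ω t = B i (min t h) ω := by
    intro i
    refine exists_measurable_path (fun t => (hG i).aemeasurable t) ?_
    filter_upwards [(hI.bridge i).continuous] with ω hω
    exact hω.comp_continuous (by fun_prop) hmin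
  choose β mβ hβ using hex
  have hβt : ∀ i t, (fun ω => β i ω t) =ᵐ[P'] B i (min t h) := fun i t =>
    (hβ i).mono fun ω hω => hω t
  have hGβ : ∀ i, IsGaussianProcess (fun t ω => β i ω t) P' := fun i =>
    (hG i).congr fun t => (hβt i t).symm
  have mβ' : Measurable fun ω i => β i ω := measurable_pi_lambda _ mβ
  have hlaw : ∀ i, P'.map (β i) = P.map (fun ω => pathBridge h hc ω i) := by
    intro i
    refine IsGaussianProcess.map_path_eq (mβ i)
      (mP i) (hGβ i)
      ((isGaussianProcess_pathBridge hB hc).comp_right fun t => ⟨i, t⟩) (fun t => ?_) fun s t => ?_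
    · rw [integral_congr_ae (hβt i t), (hI.bridge i).mean _ (min_le_right _ _),
        integral_pathBridge hB hc]
    · rw [covariance_pathBridge hB hh hc, if_pos rfl, covariance_congr_ae (hβt i s) (hβt i t)]
      wlog hst : s ≤ t generalizing s t
      · rw [covariance_comm, this t s (le_of_not_ge hst), bridgeCov, bridgeCov, min_comm, mul_comm]
      rw [(hI.bridge i).covariance _ _ (min_le_min_right h hst) (min_le_right _ _), bridgeCov,
        min_eq_left (min_le_min_right h hst)]
  have hind : iIndepFun β P' := by
    have h1 : iIndepFun (fun i ω (t : ℝ≥0) => B i (min t h) ω) P' :=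
      hI.indep.comp (fun _ f t => f ⟨min t h, hmin t⟩)
        fun _ => measurable_pi_lambda _ fun t => measurable_pi_apply _
    have h2 : iIndepFun (fun i ω (t : ℝ≥0) => β i ω t) P' :=
      h1.process_congr fun i t => (hβt i t).symm
    rw [iIndepFun_iff_iIndep] at h2 ⊢
    convert h2 using 2 with i
    exact comap_pathSigma _
  have hmap : P'.map (fun ω i => β i ω) = P.map (pathBridge h hc) := by
    rw [(iIndepFun_iff_map_fun_eq_infinitePi_map mβ).1 hind,
      (iIndepFun_iff_map_fun_eq_infinitePi_map
        mP).1 (iIndepFun_pathBridge hB hh hc)]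
    simp_rw [hlaw]
  refine ⟨fun ω i => β i ω, mβ', hmap, ?_⟩
  have hends : ∀ᵐ ω ∂P', ∀ i, β i ω 0 = 0 ∧ β i ω h = 0 := by
    refine ae_all_iff.2 fun i => ?_
    have hS : MeasurableSet {x : PathSpace | x 0 = 0 ∧ x h = 0} :=
      (measurable_pathEval 0 (measurableSet_singleton 0)).inter
        (measurable_pathEval h (measurableSet_singleton 0))
    refine (ae_map_iff (mβ i).aemeasurable hS).1 ?_
    rw [hlaw i, ae_map_iff
      (mP i).aemeasurable hS]
    exact ae_of_all _ fun ω => ⟨bridgeOf_zero _ _, bridgeOf_of_ge hh _ le_rfl⟩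
  filter_upwards [hends, ae_all_iff.2 hβ] with ω h1 h2 i u hu
  rw [bridgeOf_of_le (h1 i).1 (h1 i).2 hu, h2, min_eq_left hu]

end Bridges

/-! ### Translation of a Gaussian variable -/

noncomputable section

/-- The `L¹` distance of the densities of `N(0, 1)` and `N(a, 1)`. -/
def gaussianShiftDist (a : ℝ) : ℝ≥0∞ :=
  ∫⁻ x, ‖gaussianPDFReal 0 1 x - gaussianPDFReal a 1 x‖ₑ

end

theorem gaussianReal_shift_le (a : ℝ) (A : Set ℝ) :
    gaussianReal a 1 A ≤ gaussianReal 0 1 A + gaussianShiftDist a := by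
  rw [gaussianReal_apply _ one_ne_zero, gaussianReal_apply _ one_ne_zero]
  calc ∫⁻ x in A, gaussianPDF a 1 x
      ≤ ∫⁻ x in A, (gaussianPDF 0 1 x + ‖gaussianPDFReal 0 1 x - gaussianPDFReal a 1 x‖ₑ) := by
        refine lintegral_mono fun x => ?_
        rw [gaussianPDF, gaussianPDF, Real.enorm_eq_ofReal_abs,
          ← ENNReal.ofReal_add (gaussianPDFReal_nonneg _ _ _) (abs_nonneg _)]
        refine ENNReal.ofReal_le_ofReal ?_
        linarith [neg_abs_le (gaussianPDFReal 0 1 x - gaussianPDFReal a 1 x)]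
    _ = (∫⁻ x in A, gaussianPDF 0 1 x)
        + ∫⁻ x in A, ‖gaussianPDFReal 0 1 x - gaussianPDFReal a 1 x‖ₑ :=
      lintegral_add_left (measurable_gaussianPDF _ _) _
    _ ≤ _ := by
      gcongr
      exact setLIntegral_le_lintegral _ _

theorem tendsto_gaussianShiftDist :
    Filter.Tendsto gaussianShiftDist (nhds 0) (nhds 0) := by
  have hpdf : ∀ a x : ℝ, gaussianPDFReal a 1 x = (√(2 * Real.pi))⁻¹ * Real.exp (-(x - a) ^ 2 / 2) := by
    intro a x
    simp [gaussianPDFReal]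
  -- For `|a| ≤ 1`, `(x - a) ^ 2 ≥ x ^ 2 / 2 - 1`, so `g / 2` dominates each of the two densities.
  let g : ℝ → ℝ := fun x => 2 * ((√(2 * Real.pi))⁻¹ * (Real.exp (1 / 2) * Real.exp (-(1 / 4) * x ^ 2)))
  have hb : ∀ a x : ℝ, |a| ≤ 1 → gaussianPDFReal a 1 x ≤ g x / 2 := by
    intro a x ha
    rw [hpdf]
    have h1 : a ^ 2 ≤ 1 := by nlinarith [sq_abs a, abs_nonneg a]
    have h2 : -(x - a) ^ 2 / 2 ≤ 1 / 2 + -(1 / 4) * x ^ 2 := by nlinarith [sq_nonneg (x - 2 * a)]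
    have h3 := Real.exp_le_exp.2 h2
    have h4 : g x / 2 = (√(2 * Real.pi))⁻¹ * Real.exp (1 / 2 + -(1 / 4) * x ^ 2) := by
      simp only [g, Real.exp_add]
      ring
    rw [h4]
    gcongr
  have hg : Integrable g :=
    (((integrable_exp_neg_mul_sq (by norm_num : (0 : ℝ) < 1 / 4)).const_mul _).const_mul _).const_mul _
  have h0 : ∫⁻ _ : ℝ, (0 : ℝ≥0∞) = 0 := by simp
  rw [← h0]
  refine tendsto_lintegral_filter_of_dominated_convergence (fun x => ‖g x‖ₑ) ?_ ?_ ?_ ?_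
  · exact Filter.Eventually.of_forall fun a =>
      ((measurable_gaussianPDFReal 0 1).sub (measurable_gaussianPDFReal a 1)).enorm
  · have : ∀ᶠ a : ℝ in nhds 0, |a| ≤ 1 := by
      filter_upwards [Metric.ball_mem_nhds (0 : ℝ) one_pos] with a ha
      have : |a| < 1 := by simpa using ha
      exact this.le
    filter_upwards [this] with a ha
    refine ae_of_all _ fun x => enorm_le_iff_norm_le.2 ?_
    rw [Real.norm_eq_abs, Real.norm_eq_abs]
    have h1 := hb a x ha
    have h2 := hb 0 x (by simp)
    have h3 := gaussianPDFReal_nonneg a 1 x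
    have h4 := gaussianPDFReal_nonneg 0 1 x
    refine (abs_le.2 ⟨?_, ?_⟩ : _ ≤ g x).trans (le_abs_self _) <;> linarith
  · exact hg.2.ne
  · refine ae_of_all _ fun x => ?_
    have hc : Continuous fun a : ℝ => ‖gaussianPDFReal 0 1 x - gaussianPDFReal a 1 x‖ₑ := by
      simp only [hpdf]
      fun_prop
    simpa using hc.tendsto 0

/-- By Fubini, `U` may be frozen and the one-dimensional bound applied to each section of `S`. -/
theorem IndepFun.measure_shift_le {Ω E : Type*} [MeasurableSpace Ω] [MeasurableSpace E]
    {P : Measure Ω} [IsProbabilityMeasure P] {U : Ω → E} {G : Ω → ℝ} (mU : Measurable U)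
    (mG : Measurable G) (hUG : IndepFun U G P) (hG : P.map G = gaussianReal 0 1) (a : ℝ)
    {S : Set (E × ℝ)} (hS : MeasurableSet S) :
    P {ω | (U ω, G ω + a) ∈ S} ≤ P {ω | (U ω, G ω) ∈ S} + gaussianShiftDist a := by
  have := Measure.isProbabilityMeasure_map (μ := P) mU.aemeasurable
  have hGa : P.map (fun ω => G ω + a) = gaussianReal a 1 := by
    have := gaussianReal_map_add_const (μ := 0) (v := 1) a
    rw [← hG, Measure.map_map (by fun_prop) mG, zero_add] at this
    exact this
  have hUGa : IndepFun U (fun ω => G ω + a) P :=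
    hUG.comp measurable_id (measurable_id.add_const a)
  have e1 : P {ω | (U ω, G ω + a) ∈ S} = ∫⁻ u, gaussianReal a 1 (Prod.mk u ⁻¹' S) ∂(P.map U) := by
    rw [← Measure.prod_apply hS, ← hGa,
      ← hUGa.map_prod_eq_prod_map_map mU.aemeasurable (mG.add_const a).aemeasurable,
      Measure.map_apply (mU.prodMk (mG.add_const a)) hS]
    rfl
  have e2 : P {ω | (U ω, G ω) ∈ S} = ∫⁻ u, gaussianReal 0 1 (Prod.mk u ⁻¹' S) ∂(P.map U) := by
    rw [← Measure.prod_apply hS, ← hG,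
      ← hUG.map_prod_eq_prod_map_map mU.aemeasurable mG.aemeasurable,
      Measure.map_apply (mU.prodMk mG) hS]
    rfl
  rw [e1, e2]
  calc ∫⁻ u, gaussianReal a 1 (Prod.mk u ⁻¹' S) ∂(P.map U)
      ≤ ∫⁻ u, (gaussianReal 0 1 (Prod.mk u ⁻¹' S) + gaussianShiftDist a) ∂(P.map U) :=
        lintegral_mono fun u => gaussianReal_shift_le a _
    _ = _ := by
      rw [lintegral_add_right _ measurable_const]
      simp

/-! ### Events determined by an initial segment of the path -/

theorem mem_iff_of_eqOn {t : ℝ≥0} {A : Set PathSpace} (hA : MeasurableSet[rawPathFiltration t] A)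
    {x y : PathSpace} (hxy : ∀ u ≤ t, x u = y u) : x ∈ A ↔ y ∈ A := by
  have hle : rawPathFiltration t ≤
      MeasurableSpace.comap (fun (x : PathSpace) (u : Set.Iic t) => x u) MeasurableSpace.pi := by
    refine iSup₂_le fun u hu => ?_
    rw [MeasurableSpace.pi, MeasurableSpace.comap_iSup]
    refine le_trans ?_ (le_iSup _ (⟨u, hu⟩ : Set.Iic t))
    rw [MeasurableSpace.comap_comp]
    exact le_rfl
  obtain ⟨S, -, rfl⟩ := hle A hA
  have : (fun u : Set.Iic t => x u) = fun u : Set.Iic t => y u := funext fun u => hxy u u.2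
  simp only [Set.mem_preimage, this]

/-! ### Shifting one bridge, and the right-continuous past of a grid time -/

section Germ

variable {Ω : Type*} [MeasurableSpace Ω] {P : Measure Ω} {W : ℝ≥0 → Ω → ℝ} {h : ℝ≥0}

theorem bridgeCov_of_le {s t : ℝ≥0} (hst : s ≤ t) (ht : t ≤ h) :
    bridgeCov h s t = (s : ℝ) * (1 - t / h) := by
  rw [bridgeCov, min_eq_left ht, min_eq_left (hst.trans ht), min_eq_left hst]
  ring

theorem continuous_bridgeCov_left (h t : ℝ≥0) : Continuous fun s => bridgeCov h s t := by
  unfold bridgeCov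
  fun_prop

noncomputable section

/-- The covariance of a Brownian bridge on `[0, h]` with its normalized value at time `ε`. -/
def bridgeDirection (h ε : ℝ≥0) : PathSpace where
  toFun u := bridgeCov h u ε / √((ε : ℝ) * (1 - ε / h))
  continuous_toFun := (continuous_bridgeCov_left h ε).div_const _

/-- Addition of a multiple of `bridgeDirection h ε` to the path of index `n`. -/
def shiftBridge (h ε : ℝ≥0) (n : ℕ) (w : ℕ → PathSpace) (y : ℝ) (i : ℕ) : PathSpace :=
  w i + if i = n then y • bridgeDirection h ε else 0

end

theorem bridgeDirection_apply (h ε u : ℝ≥0) :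
    bridgeDirection h ε u = bridgeCov h u ε / √((ε : ℝ) * (1 - ε / h)) := rfl

theorem shiftBridge_apply (h ε : ℝ≥0) (n : ℕ) (w : ℕ → PathSpace) (y : ℝ) (i : ℕ) (u : ℝ≥0) :
    shiftBridge h ε n w y i u = w i u + if i = n then y * bridgeDirection h ε u else 0 := by
  unfold shiftBridge
  split_ifs <;> simp

theorem shiftBridge_add (h ε : ℝ≥0) (n : ℕ) (w : ℕ → PathSpace) (y y' : ℝ) :
    shiftBridge h ε n (shiftBridge h ε n w y) y' = shiftBridge h ε n w (y + y') := by
  ext i u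
  simp only [shiftBridge_apply]
  split_ifs <;> ring

theorem shiftBridge_zero (h ε : ℝ≥0) (n : ℕ) (w : ℕ → PathSpace) :
    shiftBridge h ε n w 0 = w := by
  ext i u
  simp [shiftBridge_apply]

theorem measurable_shiftBridge (h ε : ℝ≥0) (n : ℕ) :
    Measurable fun p : (ℕ → PathSpace) × ℝ => shiftBridge h ε n p.1 p.2 := by
  refine measurable_pi_lambda _ fun i => measurable_toPath fun u => ?_
  simp only [shiftBridge_apply]
  have h1 : Measurable fun p : (ℕ → PathSpace) × ℝ => p.1 i u :=
    (measurable_pathEval u).comp ((measurable_pi_apply i).comp measurable_fst)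
  split_ifs
  · exact h1.add (measurable_snd.mul_const _)
  · exact h1.add_const 0

/-- On `[0, ε]` the direction is linear, with slope `√(1 - ε / h) / √ε`. The multiple is chosen so
that, after multiplication by `σ (z n)`, the added slope is `(z' (n + 1) - z (n + 1)) / h`, the
difference of the chords. -/
theorem interpPath_shift_eqOn {σ : ℝ → ℝ} (hh : 0 < h) {ε : ℝ≥0} (hε : 0 < ε) (hεh : ε < h) {n : ℕ}
    {z z' : ℕ → ℝ} (hz : ∀ i ≤ n, z i = z' i) (hσ : σ (z n) ≠ 0) {w : ℕ → PathSpace}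
    (hw : bridgeOf h (w n) = w n) {t : ℝ≥0} (ht : t ≤ n * h + ε) :
    interpPath σ hh z (shiftBridge h ε n w
      ((z' (n + 1) - z (n + 1)) / (h * σ (z n)) * √(ε : ℝ) / √(1 - (ε : ℝ) / h))) t =
    interpPath σ hh z' w t := by
  have hh' : (h : ℝ) ≠ 0 := by exact_mod_cast hh.ne'
  have hε' : (0 : ℝ) < ε := by exact_mod_cast hε
  have hκ : (0 : ℝ) < 1 - ε / h := by
    have h1 : (ε : ℝ) < h := by exact_mod_cast hεh
    rw [sub_pos, div_lt_one (by exact_mod_cast hh)]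
    exact h1
  obtain ⟨j, u, hu, rfl⟩ := exists_grid_add hh t
  rw [isBridgedPath_interpPath σ hh _ _ j u hu.le, isBridgedPath_interpPath σ hh _ _ j u hu.le]
  have hjn : j ≤ n := by
    by_contra hcon
    have h1 : ((n : ℝ≥0) + 1) * h ≤ j * h := by
      gcongr
      exact_mod_cast Nat.lt_of_not_le hcon
    have h2 : (n * h + h : ℝ≥0) ≤ n * h + ε := by
      calc (n * h + h : ℝ≥0) = (n + 1) * h := by ring
        _ ≤ j * h := h1
        _ ≤ j * h + u := le_add_of_nonneg_right zero_le
        _ ≤ _ := ht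
    exact absurd (le_of_add_le_add_left h2) (not_le.2 hεh)
  rcases hjn.lt_or_eq with hlt | rfl
  · have e : bridgeOf h (shiftBridge h ε n w ((z' (n + 1) - z (n + 1)) / (h * σ (z n)) * √(ε : ℝ)
        / √(1 - (ε : ℝ) / h)) j) = bridgeOf h (w j) :=
      bridgeOf_congr fun u _ => by simp [shiftBridge_apply, hlt.ne]
    beta_reduce
    rw [e, hz j hjn, hz (j + 1) hlt]
  · have huε : u ≤ ε := le_of_add_le_add_left ht
    beta_reduce
    have hw0 : w j 0 = 0 := by rw [← hw, bridgeOf_zero]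
    have hwh : w j h = 0 := by rw [← hw, bridgeOf_of_ge hh _ le_rfl]
    rw [hw, bridgeOf_of_le _ _ hu.le, shiftBridge_apply, if_pos rfl, bridgeDirection_apply,
      bridgeCov_of_le huε hεh.le, ← hz j le_rfl, Real.sqrt_mul hε'.le]
    · have h1 : √(ε : ℝ) ≠ 0 := (Real.sqrt_pos.2 hε').ne'
      have h2 : √(1 - (ε : ℝ) / h) ≠ 0 := (Real.sqrt_pos.2 hκ).ne'
      have h3 : (1 - (ε : ℝ) / h) = √(1 - (ε : ℝ) / h) * √(1 - (ε : ℝ) / h) :=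
        (Real.mul_self_sqrt hκ.le).symm
      generalize √(1 - (ε : ℝ) / h) = κ at *
      rw [h3]
      field_simp
      ring
    · rw [shiftBridge_apply, hw0, bridgeDirection_apply, bridgeCov_of_le zero_le hεh.le]
      simp
    · rw [shiftBridge_apply, hwh, bridgeDirection_apply, bridgeCov, min_self, min_eq_left hεh.le,
        min_eq_right hεh.le]
      field_simp
      simp

/-- The change from `z` to `z'` is invisible to `A` once the `n`-th bridge is shifted, and such a
shift only translates its normalized value at `ε`, a standard Gaussian variable independent of the
rest. -/
theorem measure_interpPath_le (hB : IsPreBrownianReal W P) (hh : 0 < h)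
    (hc : ∀ ω, Continuous fun t => W t ω) (hm : ∀ t, Measurable (W t)) {σ : ℝ → ℝ}
    (hσm : Measurable σ) {ε : ℝ≥0} (hε : 0 < ε) (hεh : ε < h) {n : ℕ} {z z' : ℕ → ℝ}
    (hz : ∀ i ≤ n, z i = z' i) (hσ : σ (z n) ≠ 0) {A : Set PathSpace}
    (hA : MeasurableSet[rawPathFiltration (n * h + ε)] A) :
    P {ω | interpPath σ hh z' (pathBridge h hc ω) ∈ A} ≤
      P {ω | interpPath σ hh z (pathBridge h hc ω) ∈ A} + gaussianShiftDist
        ((z' (n + 1) - z (n + 1)) / (h * σ (z n)) * √(ε : ℝ) / √(1 - (ε : ℝ) / h)) := by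
  have := hB.isGaussianProcess.isProbabilityMeasure
  set a := (z' (n + 1) - z (n + 1)) / (h * σ (z n)) * √(ε : ℝ) / √(1 - (ε : ℝ) / h) with ha
  have hv : (0 : ℝ) < ε * (1 - ε / h) := by
    have h0 : (0 : ℝ) < ε := by exact_mod_cast hε
    have h1 : (ε : ℝ) < h := by exact_mod_cast hεh
    refine mul_pos h0 ?_
    rw [sub_pos, div_lt_one (h0.trans h1)]
    exact h1
  set v := (ε : ℝ) * (1 - ε / h) with hvdef
  have hsv : √v ≠ 0 := (Real.sqrt_pos.2 hv).ne'
  -- `G` is the normalized value at `ε`, and `U` the bridges minus their regression on `G`; hence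
  -- `U` and `G` are uncorrelated and jointly Gaussian.
  let G : Ω → ℝ := fun ω => (√v)⁻¹ * pathBridge h hc ω n ε
  let U : Ω → ℕ → PathSpace := fun ω => shiftBridge h ε n (pathBridge h hc ω) (-G ω)
  have mβ := measurable_pathBridge (h := h) hc hm
  have mY : Measurable fun ω => pathBridge h hc ω n ε :=
    (measurable_pathEval ε).comp ((measurable_pi_apply n).comp mβ)
  have mG : Measurable G := mY.const_mul _
  have mU : Measurable U := (measurable_shiftBridge h ε n).comp (mβ.prodMk mG.neg)
  have hβ := isGaussianProcess_pathBridge (h := h) hB hc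
  have hβ2 := memLp_pathBridge (h := h) hB hc
  have hvar : cov[fun ω => pathBridge h hc ω n ε, fun ω => pathBridge h hc ω n ε; P] = v := by
    rw [covariance_pathBridge hB hh hc, if_pos rfl, bridgeCov_of_le le_rfl hεh.le]
  have hGlaw : P.map G = gaussianReal 0 1 := by
    have h1 : HasGaussianLaw (fun ω => pathBridge h hc ω n ε) P := hβ.hasGaussianLaw_eval ⟨n, ε⟩
    have h2 := h1.map_eq_gaussianReal
    rw [integral_pathBridge hB hc, ← covariance_self h1.aemeasurable, hvar] at h2
    have h3 := gaussianReal_map_const_mul (μ := 0) (v := v.toNNReal) (√v)⁻¹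
    rw [← h2, Measure.map_map (by fun_prop) mY, mul_zero] at h3
    refine h3.trans ?_
    congr 1
    ext
    push_cast
    rw [Real.coe_toNNReal _ hv.le]
    field_simp
    exact (Real.sq_sqrt hv.le).symm
  have hU : ∀ i u ω, U ω i u = pathBridge h hc ω i u
      - (if i = n then (√v)⁻¹ * bridgeDirection h ε u else 0) * pathBridge h hc ω n ε := by
    intro i u ω
    simp only [U, shiftBridge_apply, G]
    split_ifs <;> ring
  have hUG : IndepFun U G P := by
    have hJ : IsGaussianProcess (Sum.elim (fun (p : (_ : ℕ) × ℝ≥0) ω => U ω p.1 p.2)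
        (fun (_ : Unit) => G)) P := by
      classical
      refine hβ.of_isGaussianProcess ?_
      rintro (⟨i, u⟩ | _)
      · refine ⟨{⟨i, u⟩, ⟨n, ε⟩},
          { toFun x := x ⟨⟨i, u⟩, by simp⟩ -
              (if i = n then (√v)⁻¹ * bridgeDirection h ε u else 0) * x ⟨⟨n, ε⟩, by simp⟩
            map_add' x y := by simp only [Pi.add_apply]; ring
            map_smul' c x := by simp only [Pi.smul_apply, smul_eq_mul, RingHom.id_apply]; ring },
          fun ω => ?_⟩
        simp only [Sum.elim_inl, hU]
        rfl
      · exact ⟨{⟨n, ε⟩},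
          { toFun x := (√v)⁻¹ * x ⟨⟨n, ε⟩, by simp⟩
            map_add' x y := by simp; ring
            map_smul' c x := by simp; ring }, by simp [G]⟩
    have h1 := hJ.indepFun_of_covariance_eq_zero (fun p => hJ.aemeasurable (Sum.inl p))
      (fun q => hJ.aemeasurable (Sum.inr q)) fun p _ => by
        simp_rw [hU]
        rw [covariance_const_mul_right, covariance_fun_sub_left (hβ2 _ _) ((hβ2 _ _).const_mul _)
          (hβ2 _ _), covariance_const_mul_left, hvar, covariance_pathBridge hB hh hc]
        split_ifs
        · rw [bridgeDirection_apply, ← hvdef]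
          have hs : √v * √v = v := Real.mul_self_sqrt hv.le
          generalize √v = r at *
          rw [← hs]
          field_simp
          ring
        · simp
    have h2 := h1.comp measurable_id (measurable_pi_apply ())
    rw [IndepFun_iff_Indep] at h2 ⊢
    rw [comap_pathSeq]
    exact h2
  have hAm : MeasurableSet A := rawPathFiltration.le _ _ hA
  have hS : MeasurableSet {p : (ℕ → PathSpace) × ℝ |
      interpPath σ hh z (shiftBridge h ε n p.1 p.2) ∈ A} :=
    ((measurable_interpPath hσm hh).comp
      (measurable_const.prodMk (measurable_shiftBridge h ε n))) hAm
  have key := IndepFun.measure_shift_le mU mG hUG hGlaw a hS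
  convert key using 2
  · congr 1
    ext ω
    simp only [Set.mem_ofPred_eq, U, shiftBridge_add]
    -- Putting `G + a` in place of `G` restores the bridges and shifts the `n`-th one by `a` times
    -- the direction.
    rw [show -G ω + (G ω + a) = a by ring]
    exact (mem_iff_of_eqOn hA fun t ht =>
      interpPath_shift_eqOn hh hε hεh hz hσ (bridgeOf_pathBridge hh hc ω n) ht).symm
  · congr 1
    ext ω
    simp only [Set.mem_ofPred_eq, U, shiftBridge_add, neg_add_cancel, shiftBridge_zero]

/-- The law of the interpolating path on the right-continuous `σ`-algebra of the past of `nh`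
depends on the first `n + 1` terms of the sequence only. -/
theorem measure_interpPath_eq (hB : IsPreBrownianReal W P) (hh : 0 < h)
    (hc : ∀ ω, Continuous fun t => W t ω) (hm : ∀ t, Measurable (W t)) {σ : ℝ → ℝ}
    (hσm : Measurable σ) (hσ : ∀ x, σ x ≠ 0) {n : ℕ} {z z' : ℕ → ℝ} (hz : ∀ i ≤ n, z i = z' i)
    {A : Set PathSpace} (hA : MeasurableSet[pathFiltration (n * h)] A) :
    P {ω | interpPath σ hh z (pathBridge h hc ω) ∈ A} =
      P {ω | interpPath σ hh z' (pathBridge h hc ω) ∈ A} := by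
  have hA' : ∀ ε : ℝ≥0, 0 < ε → MeasurableSet[rawPathFiltration (n * h + ε)] A := by
    intro ε hε
    rw [pathFiltration, Filtration.rightCont_eq] at hA
    exact iInf₂_le (f := fun j (_ : j > (n * h : ℝ≥0)) => rawPathFiltration j) (n * h + ε)
      (lt_add_of_pos_right _ hε) A hA
  have key : ∀ {z z' : ℕ → ℝ}, (∀ i ≤ n, z i = z' i) →
      P {ω | interpPath σ hh z' (pathBridge h hc ω) ∈ A} ≤
        P {ω | interpPath σ hh z (pathBridge h hc ω) ∈ A} := by
    intro z z' hz
    -- The translation vanishes at `ε = 0`, while `A` is determined by time `nh + ε` for every `ε >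
    -- 0`.
    have hcont : ContinuousAt (fun ε : ℝ≥0 => (z' (n + 1) - z (n + 1)) / (h * σ (z n)) * √(ε : ℝ)
        / √(1 - (ε : ℝ) / h)) 0 := by
      refine ContinuousAt.div (by fun_prop) (by fun_prop) ?_
      simp
    have h0 := hcont.tendsto
    simp only [NNReal.coe_zero, Real.sqrt_zero, mul_zero, zero_div] at h0
    have h1 := (tendsto_gaussianShiftDist.comp h0).mono_left
      (nhdsWithin_le_nhds (s := Set.Ioi (0 : ℝ≥0)))
    have h2 := h1.const_add (P {ω | interpPath σ hh z (pathBridge h hc ω) ∈ A})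
    rw [add_zero] at h2
    refine ge_of_tendsto h2 ?_
    filter_upwards [Ioo_mem_nhdsGT hh] with ε hε
    exact measure_interpPath_le hB hh hc hm hσm hε.1 hε.2 hz (hσ _) (hA' ε hε.1)
  exact le_antisymm (key fun i hi => (hz i hi).symm) (key hz)

end Germ

/-! ### Independence of the discrete scheme and the bridges -/

section Independence

variable {Ω : Type*} [m : MeasurableSpace Ω] {P : Measure Ω} {𝒜 : Filtration ℝ≥0 m}
  {W : ℝ≥0 → Ω → ℝ} {h : ℝ≥0}

theorem IsFilteredBrownian.measurable (hW : IsFilteredBrownian 𝒜 W P) (t : ℝ≥0) :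
    Measurable (W t) :=
  (hW.adapted t).mono (𝒜.le t) le_rfl

theorem IsFilteredBrownian.isPreBrownianReal (hW : IsFilteredBrownian 𝒜 W P) :
    IsPreBrownianReal W P :=
  hW.brownian.toIsPreBrownianReal

/-- The pair (bridges, grid increments) is a functional of `W - W 0`, hence independent of `η`;
bridges and grid increments are independent of each other. So the bridges are independent of
(increments, `η`), from which the scheme is computed recursively. -/
theorem indepFun_eulerScheme_pathBridge (hW : IsFilteredBrownian 𝒜 W P) {σ b : ℝ → ℝ}
    (hσ : Measurable σ) (hb : Measurable b) (hh : 0 < h) {η : Ω → ℝ} (hη : Measurable[𝒜 0] η) :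
    IndepFun (eulerScheme σ b h W η) (pathBridge h hW.continuous) P := by
  have := hW.isPreBrownianReal.isGaussianProcess.isProbabilityMeasure
  have mW := hW.measurable
  let D : Ω → ℕ → ℝ := fun ω i => W (i * h + h) ω - W (i * h) ω
  let β : Ω → ((_ : ℕ) × ℝ≥0) → ℝ := fun ω p => pathBridge h hW.continuous ω p.1 p.2
  have mD : Measurable D := measurable_pi_lambda _ fun i => (mW _).sub (mW _)
  have mβ : Measurable β := measurable_pi_lambda _ fun p => (measurable_pathEval p.2).comp
    ((measurable_pi_apply p.1).comp (measurable_pathBridge hW.continuous mW))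
  have mη : Measurable η := hη.mono (𝒜.le 0) le_rfl
  let F : (ℝ≥0 → ℝ) → (((_ : ℕ) × ℝ≥0) → ℝ) × (ℕ → ℝ) := fun f =>
    (fun p => (f (p.1 * h + min p.2 h) - f (p.1 * h))
      - ((min p.2 h : ℝ≥0) : ℝ) / h * (f (p.1 * h + h) - f (p.1 * h)),
      fun i => f (i * h + h) - f (i * h))
  have mF : Measurable F := by fun_prop
  have h1 : IndepFun (fun ω => (β ω, D ω)) η P := by
    have h2 := (hW.indepFun_process hη).comp measurable_id mF
    refine IndepFun.symm ?_
    have e : (fun ω => (β ω, D ω)) = F ∘ fun ω t => W t ω - W 0 ω := by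
      funext ω
      refine Prod.ext (funext fun p => ?_) (funext fun i => ?_)
      · simp only [β, F, Function.comp_apply, pathBridge_apply]
        ring
      · simp only [D, F, Function.comp_apply]
        ring
    rw [e]
    exact h2
  have h2 : IndepFun D (pathBridge h hW.continuous) P :=
    indepFun_increment_pathBridge hW.isPreBrownianReal hh hW.continuous
  have h3 : IndepFun β D P := by
    rw [IndepFun_iff_Indep] at h2 ⊢
    rw [comap_pathSeq] at h2
    exact h2.symm
  have h4 := IndepFun.prodMk_right_of_prodMk_left mβ mD mη h1 h3
  rw [IndepFun_iff_Indep] at h4 ⊢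
  rw [comap_pathSeq]
  refine (indep_of_indep_of_le_right h4 ?_).symm
  have hm : Measurable[MeasurableSpace.comap (fun ω => (D ω, η ω)) inferInstance]
      fun ω => (D ω, η ω) := comap_measurable _
  have hD : ∀ i, Measurable[MeasurableSpace.comap (fun ω => (D ω, η ω)) inferInstance]
      fun ω => D ω i := fun i => (measurable_pi_apply i).comp (measurable_fst.comp hm)
  have hη' : Measurable[MeasurableSpace.comap (fun ω => (D ω, η ω)) inferInstance] η :=
    measurable_snd.comp hm
  refine Measurable.comap_le (@measurable_pi_lambda _ _ _ (_) _ _ fun i => ?_)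
  induction i with
  | zero => exact hη'
  | succ i ih =>
    simp only [eulerScheme_succ σ b hh]
    have e : ∀ ω, W ((i + 1 : ℕ) * h) ω - W (i * h) ω = D ω i := fun ω => by
      simp only [D]
      rw [show ((i + 1 : ℕ) : ℝ≥0) * h = i * h + h by push_cast; ring]
    simp only [e]
    exact (ih.add ((hb.comp ih).const_mul _)).add ((hσ.comp ih).mul (hD i))

/-- Disintegration over the discrete scheme: by independence the joint law of scheme and bridges is
a product. -/
theorem IsContinuousEuler.measure_preimage (hW : IsFilteredBrownian 𝒜 W P) {σ b : ℝ → ℝ}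
    (hσ : Measurable σ) (hb : Measurable b) (hh : 0 < h) {η : Ω → ℝ} (hη : Measurable[𝒜 0] η)
    {ξ : Ω → PathSpace} (hξ : IsContinuousEuler 𝒜 W P σ b h η ξ) {A : Set PathSpace}
    (hA : MeasurableSet A) :
    ∫⁻ z, P {ω | interpPath σ hh z (pathBridge h hW.continuous ω) ∈ A}
      ∂(P.map (eulerScheme σ b h W η)) = P.map ξ A := by
  have := hW.isPreBrownianReal.isGaussianProcess.isProbabilityMeasure
  have mZ : Measurable (eulerScheme σ b h W η) :=
    measurable_eulerScheme h hσ hb hW.measurable (hη.mono (𝒜.le 0) le_rfl)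
  have mβ := measurable_pathBridge (h := h) hW.continuous hW.measurable
  have mI := measurable_interpPath hσ hh
  have e1 : ξ =ᵐ[P] fun ω => interpPath σ hh (eulerScheme σ b h W η ω)
      (pathBridge h hW.continuous ω) := by
    filter_upwards [hξ.ae_eq_interpPath hh hW.continuous] with ω hω
    rw [hω]
    exact (interpPath_bridgeOf σ hh _ _).symm
  have := Measure.isProbabilityMeasure_map (μ := P) mβ.aemeasurable
  have e2 := Measure.map_map (μ := P) mI (mZ.prodMk mβ)
  rw [Function.comp_def] at e2
  rw [Measure.map_congr e1, ← e2,
    Measure.map_apply mI hA,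
    (indepFun_eulerScheme_pathBridge hW hσ hb hh hη).map_prod_eq_prod_map_map mZ.aemeasurable
      mβ.aemeasurable, Measure.prod_apply (mI hA)]
  refine lintegral_congr fun z => ?_
  rw [Measure.map_apply mβ (measurable_prodMk_left (mI hA))]
  rfl

end Independence

/-! ### The Markov kernel -/

theorem iSup_seqFiltration : ⨆ n, seqFiltration n = MeasurableSpace.pi := by
  refine le_antisymm (iSup_le seqFiltration.le) (iSup_le fun i => ?_)
  refine le_trans ?_ (le_iSup (fun n => seqFiltration n) i)
  exact le_iSup₂ (f := fun (j : ℕ) (_ : j ≤ i) =>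
    MeasurableSpace.comap (fun x : ℕ → ℝ => x j) inferInstance) i le_rfl

theorem iSup_pathFiltration : ⨆ t, pathFiltration t = pathSigma := by
  refine le_antisymm (iSup_le pathFiltration.le) (iSup_le fun t => ?_)
  refine le_trans ?_ (le_iSup (fun t => pathFiltration t) t)
  refine le_trans ?_ (rawPathFiltration.le_rightCont t)
  exact le_iSup₂ (f := fun (j : ℝ≥0) (_ : j ≤ t) =>
    MeasurableSpace.comap (fun x : PathSpace => x j) inferInstance) t le_rfl

/-- Makes every measurable function that is unchanged by truncation measurable for the first `n + 1`
coordinates. -/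
theorem measurable_truncate (n : ℕ) :
    Measurable[seqFiltration n] fun (z : ℕ → ℝ) (i : ℕ) => z (min i n) := by
  refine @measurable_pi_lambda _ _ _ (seqFiltration n) _ _ fun i => ?_
  exact Measurable.of_comap_le (le_iSup₂ (f := fun (j : ℕ) (_ : j ≤ n) =>
    MeasurableSpace.comap (fun x : ℕ → ℝ => x j) inferInstance) (min i n) (min_le_right _ _))

theorem gridTime_le_iff {h : ℝ≥0} (hh : 0 < h) (N : (ℕ → ℝ) → WithTop ℕ) (x : PathSpace)
    (t : ℝ≥0) : gridTime h N x ≤ t ↔ N (skeleton h x) ≤ (⌊t / h⌋₊ : ℕ) := by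
  simp only [gridTime]
  cases N (skeleton h x) with
  | top => exact iff_of_false (WithTop.not_top_le_coe _) (WithTop.not_top_le_coe _)
  | coe n =>
    have h1 : (((n : ℝ≥0) * h : ℝ≥0) : WithTop ℝ≥0) ≤ t ↔ (n : ℝ≥0) * h ≤ t := WithTop.coe_le_coe
    have h2 : ((n : ℕ) : WithTop ℕ) ≤ ((⌊t / h⌋₊ : ℕ) : WithTop ℕ) ↔ n ≤ ⌊t / h⌋₊ :=
      WithTop.coe_le_coe
    have h3 : n ≤ ⌊t / h⌋₊ ↔ (n : ℝ≥0) * h ≤ t := by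
      rw [Nat.le_floor_iff (by positivity), le_div_iff₀ hh]
    exact h1.trans (h3.symm.trans h2.symm)

theorem measurable_skeleton_filtration {h : ℝ≥0} (hh : 0 < h) (t : ℝ≥0) :
    @Measurable _ _ (rawPathFiltration t) (seqFiltration ⌊t / h⌋₊) (skeleton h) := by
  rw [measurable_iff_comap_le, seqFiltration, Filtration.natural]
  simp only [MeasurableSpace.comap_iSup, MeasurableSpace.comap_comp]
  refine iSup₂_le fun i hi => ?_
  have hi' : (i : ℝ≥0) * h ≤ t := by
    rw [← le_div_iff₀ hh]
    exact (Nat.le_floor_iff (by positivity)).1 hi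
  exact le_iSup₂ (f := fun (j : ℝ≥0) (_ : j ≤ t) =>
    MeasurableSpace.comap (fun x : PathSpace => x j) inferInstance) ((i : ℝ≥0) * h) hi'

theorem measurable_skeleton (h : ℝ≥0) : Measurable (skeleton h) :=
  measurable_pi_lambda _ fun i => measurable_pathEval (i * h)

/-- By time `t` the grid values of index at most `⌊t / h⌋₊` are known, and they decide whether `Nh ≤
t`. -/
theorem measurable_skeleton_stopping {h : ℝ≥0} (hh : 0 < h) {N : (ℕ → ℝ) → WithTop ℕ}
    (hN : IsStoppingTime seqFiltration N) :
    @Measurable _ _ (isStoppingTime_gridTime hh hN).measurableSpace hN.measurableSpace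
      (skeleton h) := by
  intro S hS
  refine ⟨?_, fun t => ?_⟩
  · rw [iSup_pathFiltration]
    exact measurable_skeleton h (hN.measurableSpace_le S hS)
  · refine rawPathFiltration.le_rightCont t _ ?_
    have e : skeleton h ⁻¹' S ∩ {x | gridTime h N x ≤ t} =
        skeleton h ⁻¹' (S ∩ {z | N z ≤ (⌊t / h⌋₊ : ℕ)}) := by
      ext x
      simp only [Set.mem_inter_iff, Set.mem_preimage, Set.mem_ofPred_eq, gridTime_le_iff hh]
    rw [e]
    exact measurable_skeleton_filtration hh t (hS.2 _)

section Kernel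

variable {Ω : Type*} [MeasurableSpace Ω] {P : Measure Ω} {W : ℝ≥0 → Ω → ℝ} {h : ℝ≥0}

theorem measurable_measure_interpPath [SFinite P] (hh : 0 < h)
    (hc : ∀ ω, Continuous fun t => W t ω) (hm : ∀ t, Measurable (W t)) {σ : ℝ → ℝ}
    (hσm : Measurable σ) {A : Set PathSpace} (hA : MeasurableSet A) :
    Measurable fun z => P {ω | interpPath σ hh z (pathBridge h hc ω) ∈ A} := by
  have : Measurable fun p : (ℕ → ℝ) × Ω => interpPath σ hh p.1 (pathBridge h hc p.2) :=
    (measurable_interpPath hσm hh).comp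
      (measurable_fst.prodMk ((measurable_pathBridge hc hm).comp measurable_snd))
  exact measurable_measure_prodMk_left (this hA)

/-- If `N z ≤ n`, every path interpolating `z` has `Nh ≤ nh`, so `A` may be cut down to an event of
the right-continuous past of `nh`, whose probability depends on `z 0, …, z n` alone. -/
theorem measurable_measure_interpPath_stopping (hB : IsPreBrownianReal W P) (hh : 0 < h)
    (hc : ∀ ω, Continuous fun t => W t ω) (hm : ∀ t, Measurable (W t)) {σ : ℝ → ℝ}
    (hσm : Measurable σ) (hσ : ∀ x, σ x ≠ 0) {N : (ℕ → ℝ) → WithTop ℕ}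
    (hN : IsStoppingTime seqFiltration N) {A : Set PathSpace}
    (hA : MeasurableSet[(isStoppingTime_gridTime hh hN).measurableSpace] A) :
    Measurable[hN.measurableSpace]
      fun z => P {ω | interpPath σ hh z (pathBridge h hc ω) ∈ A} := by
  have := hB.isGaussianProcess.isProbabilityMeasure
  have hle := (isStoppingTime_gridTime hh hN).measurableSpace_le
  intro S hS
  refine ⟨?_, fun n => ?_⟩
  · rw [iSup_seqFiltration]
    exact measurable_measure_interpPath hh hc hm hσm (hle A hA) hS
  · let g : (ℕ → ℝ) → ℝ≥0∞ := fun z => P {ω | interpPath σ hh z (pathBridge h hc ω) ∈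
      A ∩ {x | gridTime h N x ≤ (n * h : ℝ≥0)}}
    have hAn := hA.2 (n * h)
    have hg : Measurable[seqFiltration n] g := by
      have e : g = g ∘ fun z i => z (min i n) := by
        ext z
        exact measure_interpPath_eq hB hh hc hm hσm hσ (fun i hi => by simp only [min_eq_left hi]) hAn
      rw [e]
      exact (measurable_measure_interpPath hh hc hm hσm (pathFiltration.le _ _ hAn)).comp
        (measurable_truncate n)
    have e : (fun z => P {ω | interpPath σ hh z (pathBridge h hc ω) ∈ A}) ⁻¹' S ∩ {z | N z ≤ WithTop.some n} =
        g ⁻¹' S ∩ {z | N z ≤ WithTop.some n} := by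
      ext z
      simp only [Set.mem_inter_iff, Set.mem_preimage, Set.mem_ofPred_eq, g]
      refine and_congr_left fun hz => ?_
      have : ∀ ω, gridTime h N (interpPath σ hh z (pathBridge h hc ω)) ≤ (n * h : ℝ≥0) := by
        intro ω
        rw [gridTime_le_iff hh, skeleton_interpPath, mul_div_cancel_right₀ _ hh.ne',
          Nat.floor_natCast]
        exact hz
      simp only [this, and_true]
    rw [e]
    exact (hg hS).inter (hN n)

/-- The Markov kernel, for the stopped `σ`-algebras, of the interpolation by Brownian bridges. -/
theorem exists_bridge_kernel (hB : IsPreBrownianReal W P) (hh : 0 < h)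
    (hc : ∀ ω, Continuous fun t => W t ω) (hm : ∀ t, Measurable (W t)) {σ : ℝ → ℝ}
    (hσm : Measurable σ) (hσ : ∀ x, σ x ≠ 0) {N : (ℕ → ℝ) → WithTop ℕ}
    (hN : IsStoppingTime seqFiltration N) :
    ∃ M : @Kernel (ℕ → ℝ) PathSpace hN.measurableSpace
        (isStoppingTime_gridTime hh hN).measurableSpace,
      @IsMarkovKernel _ _ hN.measurableSpace (isStoppingTime_gridTime hh hN).measurableSpace M ∧
      ∀ z A, MeasurableSet[(isStoppingTime_gridTime hh hN).measurableSpace] A →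
        M z A = P {ω | interpPath σ hh z (pathBridge h hc ω) ∈ A} := by
  have := hB.isGaussianProcess.isProbabilityMeasure
  have hle := (isStoppingTime_gridTime hh hN).measurableSpace_le
  have mI : ∀ z, Measurable fun ω => interpPath σ hh z (pathBridge h hc ω) := fun z =>
    (measurable_interpPath hσm hh).comp (measurable_const.prodMk (measurable_pathBridge hc hm))
  let M : (ℕ → ℝ) → @Measure PathSpace (isStoppingTime_gridTime hh hN).measurableSpace := fun z =>
    (P.map fun ω => interpPath σ hh z (pathBridge h hc ω)).trim hle
  have hM : ∀ z A, MeasurableSet[(isStoppingTime_gridTime hh hN).measurableSpace] A →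
      M z A = P {ω | interpPath σ hh z (pathBridge h hc ω) ∈ A} := by
    intro z A hA
    simp only [M]
    rw [trim_measurableSet_eq hle hA, Measure.map_apply (mI z) (hle A hA)]
    rfl
  let _ := hN.measurableSpace
  let _ := (isStoppingTime_gridTime hh hN).measurableSpace
  refine ⟨⟨M, ?_⟩, ⟨fun z => ⟨?_⟩⟩, hM⟩
  · refine Measure.measurable_of_measurable_coe _ fun A hA => ?_
    simp only [hM _ A hA]
    exact measurable_measure_interpPath_stopping hB hh hc hm hσm hσ hN hA
  · exact (hM z _ MeasurableSet.univ).trans (by simp)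

/-- The event on the left need not be measurable; it differs by a null set from a measurable one,
because a bridged path exists almost surely and is unique. -/
theorem IsIndepBridges.measure_isBridgedPath {Ω' : Type*} [MeasurableSpace Ω'] {P' : Measure Ω'}
    [IsProbabilityMeasure P'] {B : ℕ → ℝ≥0 → Ω' → ℝ} (hI : IsIndepBridges h B P')
    (hB : IsPreBrownianReal W P) (hh : 0 < h) (hc : ∀ ω, Continuous fun t => W t ω)
    (hm : ∀ t, Measurable (W t)) {σ : ℝ → ℝ} (hσm : Measurable σ) (z : ℕ → ℝ) {A : Set PathSpace}
    (hA : MeasurableSet A) :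
    P' {ω | ∃ x ∈ A, IsBridgedPath σ h z (fun i u => B i u ω) x} =
      P {ω | interpPath σ hh z (pathBridge h hc ω) ∈ A} := by
  obtain ⟨β, mβ, hlaw, hβ⟩ := hI.exists_measurable hB hh hc hm
  have mI : Measurable fun w => interpPath σ hh z w :=
    (measurable_interpPath hσm hh).comp (measurable_const.prodMk measurable_id)
  have e1 : P {ω | interpPath σ hh z (pathBridge h hc ω) ∈ A} =
      P.map (pathBridge h hc) ((fun w => interpPath σ hh z w) ⁻¹' A) :=
    (Measure.map_apply (measurable_pathBridge hc hm) (mI hA)).symm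
  rw [e1, ← hlaw, Measure.map_apply mβ (mI hA)]
  refine measure_congr ?_
  filter_upwards [hβ] with ω hω
  refine propext ?_
  change (∃ x ∈ A, IsBridgedPath σ h z (fun i u => B i u ω) x) ↔ interpPath σ hh z (β ω) ∈ A
  have hI' := isBridgedPath_interpPath σ hh z (β ω)
  constructor
  · rintro ⟨x, hxA, hx⟩
    rwa [← hx.unique hh hI' fun i u hu => (hω i u hu).symm]
  · intro hx
    refine ⟨_, hx, fun i u hu => ?_⟩
    rw [hI' i u hu]
    simp only [hω i u hu]

end Kernel

/-! ### Randomizations and the deficiency -/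

/-- The integrand is measurable for the small σ-algebra, so the identity can be checked with the
untrimmed laws. -/
theorem Measure.bind_trim_eq {X Y : Type*} {m₁ mX : MeasurableSpace X} {m₂ mY : MeasurableSpace Y}
    (h₁ : m₁ ≤ mX) (h₂ : m₂ ≤ mY) (μ : @Measure X mX) (ν : @Measure Y mY) (M : @Kernel X Y m₁ m₂)
    (h : ∀ A, MeasurableSet[m₂] A → ∫⁻ x, M x A ∂μ = ν A) :
    @Measure.bind X Y m₁ m₂ (μ.trim h₁) M = ν.trim h₂ := by
  refine @Measure.ext _ m₂ _ _ fun A hA => ?_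
  rw [@Measure.bind_apply X Y m₁ m₂ _ _ _ hA (@Kernel.aemeasurable X Y m₁ m₂ M _),
    trim_measurableSet_eq h₂ hA, ← h A hA]
  exact lintegral_trim h₁ (@Kernel.measurable_coe X Y m₁ m₂ M A hA)

theorem tvDist_self {X : Type*} [MeasurableSpace X] (P : Measure X) : tvDist P P = 0 := by
  simp [tvDist]

theorem deficiency_eq_zero {Θ X Y : Type*} {E : Experiment Θ X} {F : Experiment Θ Y}
    (M : @Kernel X Y E.sigma F.sigma) (hM : @IsMarkovKernel X Y E.sigma F.sigma M)
    (h : ∀ θ, @Measure.bind X Y E.sigma F.sigma (E.law θ) M = F.law θ) : deficiency E F = 0 := by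
  let _ := E.sigma
  let _ := F.sigma
  refine le_antisymm (iInf₂_le_of_le M hM (iSup_le fun θ => ?_)) zero_le
  rw [h θ, tvDist_self]

theorem mainTheorem6 {Ω Λ : Type*} [m : MeasurableSpace Ω] (P : Measure Ω) [IsProbabilityMeasure P]
    (𝒜 : Filtration ℝ≥0 m) (W : ℝ≥0 → Ω → ℝ) (hW : IsFilteredBrownian 𝒜 W P)
    (σ : ℝ → ℝ) (σ₀ σ₁ Kσ : ℝ) (hσ : DiffusionCondition σ σ₀ σ₁ Kσ) (K : ℝ) (hK : 0 < K)
    (η : Λ → Ω → ℝ) (hη : ∀ l, Measurable[𝒜 0] (η l))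
    (h : ℝ≥0) (hh : 0 < h) (N : (ℕ → ℝ) → WithTop ℕ) (hN : IsStoppingTime seqFiltration N) :
    (∀ θ : driftClass K × Λ, ∃ ξ : Ω → PathSpace,
      IsContinuousEuler 𝒜 W P σ (θ.1 : ℝ → ℝ) h (η θ.2) ξ) ∧
    ∀ (ξ : driftClass K × Λ → Ω → PathSpace)
      (hξ : ∀ θ, IsContinuousEuler 𝒜 W P σ (θ.1 : ℝ → ℝ) h (η θ.2) (ξ θ)),
      leCamDist (discreteEulerExperiment hW hσ K hη h hN)
        (continuousEulerExperiment hh hξ hN) = 0 ∧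
      ∀ (Ω' : Type*) [MeasurableSpace Ω'] (P' : Measure Ω') [IsProbabilityMeasure P']
        (B : ℕ → ℝ≥0 → Ω' → ℝ), IsIndepBridges h B P' →
        IsBridgeRandomization σ h B P' (discreteEulerExperiment hW hσ K hη h hN)
          (continuousEulerExperiment hh hξ hN) := by
  have mσ : Measurable σ := hσ.contDiff.continuous.measurable
  have hσ0 : ∀ x, σ x ≠ 0 := fun x hx => by
    have h1 := hσ.pos.trans_le (hσ.lower x)
    simp [hx] at h1
  have mb : ∀ θ : driftClass K × Λ, Measurable (θ.1 : ℝ → ℝ) := fun θ =>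
    θ.1.2.1.continuous.measurable
  refine ⟨fun θ => ⟨_, isContinuousEuler_interpPath hW mσ (mb θ) hh (hη θ.2)⟩, fun ξ hξ => ?_⟩
  have hτ := isStoppingTime_gridTime hh hN
  obtain ⟨M, hM, hMA⟩ := exists_bridge_kernel hW.isPreBrownianReal hh hW.continuous hW.measurable
    mσ hσ0 hN
  have hbind : ∀ θ, @Measure.bind _ _ hN.measurableSpace hτ.measurableSpace
      ((discreteEulerExperiment hW hσ K hη h hN).law θ) M =
        (continuousEulerExperiment hh hξ hN).law θ := fun θ =>
    Measure.bind_trim_eq hN.measurableSpace_le hτ.measurableSpace_le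
      (P.map (eulerScheme σ (θ.1 : ℝ → ℝ) h W (η θ.2))) (P.map (ξ θ)) M fun A hA => by
        simp only [hMA _ A hA]
        exact (hξ θ).measure_preimage hW mσ (mb θ) hh (hη θ.2) (hτ.measurableSpace_le A hA)
  refine ⟨?_, fun Ω' _ P' _ B hB => ⟨M, hM, fun z A hA => ?_, hbind⟩⟩
  · have h1 := deficiency_eq_zero (E := discreteEulerExperiment hW hσ K hη h hN)
      (F := continuousEulerExperiment hh hξ hN) M hM hbind
    refine le_antisymm (max_le h1.le (le_of_eq ?_)) zero_le
    -- The reverse deficiency needs no randomness: reading the path on the grid recovers the scheme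
    -- almost surely.
    have mS := measurable_skeleton_stopping hh hN
    refine deficiency_eq_zero (E := continuousEulerExperiment hh hξ hN)
      (F := discreteEulerExperiment hW hσ K hη h hN)
      (@Kernel.deterministic _ _ hτ.measurableSpace hN.measurableSpace (skeleton h) mS)
      (@Kernel.isMarkovKernel_deterministic _ _ hτ.measurableSpace hN.measurableSpace _ mS)
      fun θ => ?_
    refine Measure.bind_trim_eq hτ.measurableSpace_le hN.measurableSpace_le (P.map (ξ θ))
      (P.map (eulerScheme σ (θ.1 : ℝ → ℝ) h W (η θ.2))) _ fun A hA => ?_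
    have hA' := hN.measurableSpace_le A hA
    have e1 : skeleton h ∘ ξ θ =ᵐ[P] eulerScheme σ (θ.1 : ℝ → ℝ) h W (η θ.2) := by
      filter_upwards [(hξ θ).ae_eq_interpPath hh hW.continuous] with ω hω
      rw [Function.comp_apply, hω, skeleton_interpPath]
    rw [← Measure.map_congr e1, ← Measure.map_map (measurable_skeleton h) (hξ θ).measurable,
      Measure.map_apply (measurable_skeleton h) hA', ← lintegral_indicator_one
        (measurable_skeleton h hA')]
    refine lintegral_congr fun x => ?_
    rw [@Kernel.deterministic_apply' _ _ hτ.measurableSpace hN.measurableSpace _ mS x A hA]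
    rfl
  · exact (hMA z A hA).trans (hB.measure_isBridgedPath hW.isPreBrownianReal hh hW.continuous
      hW.measurable mσ z (hτ.measurableSpace_le A hA)).symm
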